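/- Let $\alpha>0$. Let $M_0\subset\mathbb R^2$ be a smooth, strictly convex, complete, non-compact embedded curve whose two ends are asymptotic to the two lines $\{x_1=-1\}$ and $\{x_1=1\}$ as $x_2\to+\infty$. Let $X(p,t)$, $p\in\mathbb R$, $t\in[0,\infty)$, be a convex complete solution of the $\alpha$-curve shortening flow starting from $M_0$: $X$ is smooth for $t>0$ and continuous up to $t=0$, for each $t\ge 0$ the map $X(\cdot,t)$ is a smooth regular injective parametrization of a convex complete curve $M_t$ (the whole boundary of a closed convex set with nonempty interior), and for $t>0$ $$\frac{\partial X}{\partial t}(p,t)=\bar\kappa(p,t)^{\alpha}\,n(p,t),$$ where $\bar\kappa(p,t)\ge 0$ is the curvature of $M_t$ at $X(p,t)$ and $n(p,t)$ is the unit normal pointing towards the convex hull of $M_t$. Put $u=\bar\kappa^{\alpha}$, let $\partial_s$ denote differentiation along $M_t$ with respect to arc length, $u_s=\partial_s u$, and $B_r=\{x\in\mathbb R^2:|x|<r\}$. For every $\beta$ with $0<\beta<\min(1,1/\alpha)$ and every $L\in\mathbb R$ there is a constant $C=C(\alpha,\beta,L)$, independent of the solution, such that the following holds: if $0<u(p,t)\le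 L$ for all $t\ge 0$ and all $p$ with $X(p,t)\in B_1$, then for all $t>0$ and all $p$ with $X(p,t)\in B_{1/2}$ the function $u(\cdot,t)$ is differentiable at $p$ and $$|u_s(p,t)|\le C\,(1+t^{-1/2})\,u(p,t)^{\beta}.$$ -/

import Mathlib

open Set Filter Topology
open scoped ContDiff

namespace AlphaCSF

/-- The Euclidean plane. -/
abbrev Plane : Type := EuclideanSpace ℝ (Fin 2)

/-- Derivative `∂_s f` of a function `f` of the parameter of the regular curve `γ` with respect to
the arc length `s` of `γ`, oriented by the parameter: `∂_s = |γ'|⁻¹ ∂_p`. -/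
noncomputable def arcDeriv {F : Type*} [NormedAddCommGroup F] [NormedSpace ℝ F]
    (γ : ℝ → Plane) (f : ℝ → F) (p : ℝ) : F :=
  ‖deriv γ p‖⁻¹ • deriv f p

/-- The curvature `|∂_s ∂_s γ|` of a regular curve. For a convex curve this is the curvature with
respect to the inward normal, which is nonnegative. -/
noncomputable def curvature (γ : ℝ → Plane) (p : ℝ) : ℝ :=
  ‖arcDeriv γ (arcDeriv γ γ) p‖

/-- `γ` is a smooth regular injective parametrization, by the real line, of the whole boundary of
the closed set `K` with nonempty interior. (A connected non-compact curve is
diffeomorphic to the line. As its image is closed, such a curve is complete and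
properly embedded.) -/
structure ParametrizesBoundary (γ : ℝ → Plane) (K : Set Plane) : Prop where
  smooth : ContDiff ℝ ∞ γ
  regular : ∀ p, deriv γ p ≠ 0
  injective : Function.Injective γ
  isClosed : IsClosed K
  interior_nonempty : (interior K).Nonempty
  frontier_eq : frontier K = range γ

/-- `γ` parametrizes a smooth convex complete non-compact embedded curve. -/
def IsConvexCompleteCurve (γ : ℝ → Plane) : Prop :=
  ∃ K : Set Plane, Convex ℝ K ∧ ParametrizesBoundary γ K

/-- `γ` parametrizes a smooth strictly convex complete non-compact embedded curve. -/
def IsStrictlyConvexCompleteCurve (γ : ℝ → Plane) : Prop :=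
  ∃ K : Set Plane, StrictConvex ℝ K ∧ ParametrizesBoundary γ K

/-- Along the filter `l` of parameters, the curve `γ` is asymptotic to the vertical line `x₁ = c`
as `x₂ → +∞`. -/
def EndAsymptoticTo (γ : ℝ → Plane) (l : Filter ℝ) (c : ℝ) : Prop :=
  Tendsto (fun p => γ p 0) l (𝓝 c) ∧ Tendsto (fun p => γ p 1) l atTop

/-- The two ends of `γ` are asymptotic to the two lines `x₁ = -1` and `x₁ = 1` as `x₂ → +∞`
(in either orientation of the parameter). -/
def EndsAsymptoticToStrip (γ : ℝ → Plane) : Prop :=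
  (EndAsymptoticTo γ atBot (-1) ∧ EndAsymptoticTo γ atTop 1) ∨
    (EndAsymptoticTo γ atBot 1 ∧ EndAsymptoticTo γ atTop (-1))

/-- `n` is a unit normal of `γ` at the parameter `p` pointing to the side of the
convex hull of the curve. -/
structure IsInwardUnitNormal (γ : ℝ → Plane) (p : ℝ) (n : Plane) : Prop where
  norm_eq_one : ‖n‖ = 1
  orthogonal : inner ℝ n (deriv γ p) = 0
  inward : ∀ q, 0 ≤ inner ℝ n (γ q - γ p)

/-- The speed `u = κ^α` of the family of curves `p ↦ X p t`. -/
noncomputable def speed (α : ℝ) (X : ℝ → ℝ → Plane) (p t : ℝ) : ℝ :=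
  curvature (fun q => X q t) p ^ α

/-- `X : ℝ × [0, ∞) → ℝ²` is a convex complete solution of the `α`-curve shortening flow
`∂_t X = κ^α n`: it is smooth for `t > 0`, continuous up to `t = 0`, and each time slice,
`t = 0` included, is a smooth convex complete curve. Values of `X` at negative times play no
role. -/
structure IsConvexCompleteSolution (α : ℝ) (X : ℝ → ℝ → Plane) : Prop where
  smooth : ContDiffOn ℝ ∞ (fun z : ℝ × ℝ => X z.1 z.2) (univ ×ˢ Ioi 0)
  continuous : ContinuousOn (fun z : ℝ × ℝ => X z.1 z.2) (univ ×ˢ Ici 0)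
  convex_complete : ∀ t, 0 ≤ t → IsConvexCompleteCurve (fun p => X p t)
  flow : ∀ p t, 0 < t → ∃ n : Plane, IsInwardUnitNormal (fun q => X q t) p n ∧
    HasDerivAt (fun τ => X p τ) (speed α X p t • n) t

/-- A convex complete solution starting from a strictly convex
curve whose two ends are asymptotic to the lines `x₁ = ±1` as `x₂ → +∞`. -/
structure IsStripSolution (α : ℝ) (X : ℝ → ℝ → Plane) : Prop where
  solution : IsConvexCompleteSolution α X
  initial_strictly_convex : IsStrictlyConvexCompleteCurve (fun p => X p 0)
  initial_ends : EndsAsymptoticToStrip (fun p => X p 0)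

end AlphaCSF

/-! Let `u = κ^α` be the speed and `q = ∂_s log u` its logarithmic slope. The weighted slope
`v = u^{1-β} q = u^{-β} ∂_s u` solves
`v_t = α κ^{α-1} (v_ss + (2β + 1 - 1/α) q v_s + ((2 + 2/α - β) κ² - β (1/α - β) q²) v)`,
and for `0 < β < 1/α` the term quadratic in `q` is a damping term. At an interior maximum of
`(t - a) ((r² - |X|²) v)²` the maximum principle therefore bounds `(r² - |X|²) q`, since the
derivatives of `r² - |X|²` contribute only bounded terms and a term linear in `q`. The factor
`t - a` produces a term of order `κ / u`, whose singularity at `u = 0` for `α > 1` is absorbed by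
the factor `u^{2(1-β)}` of `v²`, again because `β < 1/α` and `β ≤ 1`.

The maximum is attained: a convex complete curve is properly embedded, and points of the unit ball
move with bounded speed, so the set of all `(p, t)` with `a ≤ t ≤ b` and `|X| ≤ r` is compact. The
estimate in the ball of radius `1/2` at time `t` follows with `r = 3/4` and `a = t/2`. -/

namespace AlphaCSF

variable {E F : Type*} [NormedAddCommGroup E] [InnerProductSpace ℝ E]
  [NormedAddCommGroup F] [NormedSpace ℝ F]

local notation "⟪" x ", " y "⟫" => inner ℝ x y

/-! ### Calculus -/

theorem deriv_deriv_nonpos_of_isLocalMax {f : ℝ → ℝ} {x : ℝ} (h : IsLocalMax f x)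
    (hf : ContinuousAt f x) : deriv (deriv f) x ≤ 0 := by
  by_contra! hpos
  have hmin : IsLocalMin f x := isLocalMin_of_deriv_deriv_pos hpos h.deriv_eq_zero hf
  have hconst : f =ᶠ[𝓝 x] fun _ => f x := by
    filter_upwards [h, hmin] with y hy hy' using le_antisymm hy hy'
  have hzero : deriv (deriv f) x = 0 := by simp [hconst.deriv.deriv_eq]
  exact hpos.ne' hzero

theorem deriv_nonneg_of_isLocalMaxOn_Iic {f : ℝ → ℝ} {x f' : ℝ} (h : IsLocalMaxOn f (Iic x) x)
    (hf : HasDerivAt f f' x) : 0 ≤ f' := by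
  refine ge_of_tendsto (hf.tendsto_slope.mono_left (nhdsLT_le_nhdsNE x)) ?_
  filter_upwards [nhdsWithin_mono x Iio_subset_Iic_self h, self_mem_nhdsWithin] with y hy hyx
  rw [slope_def_field]
  exact div_nonneg_of_nonpos (sub_nonpos.2 hy) (sub_nonpos.2 (mem_Iio.1 hyx).le)

theorem inner_self_deriv_eq_zero {f : ℝ → E} {x : ℝ} (hf : DifferentiableAt ℝ f x)
    (h : ∀ᶠ y in 𝓝 x, ‖f y‖ = 1) : ⟪f x, deriv f x⟫ = 0 := by
  have hsq : (fun y => ‖f y‖ ^ 2) =ᶠ[𝓝 x] fun _ => 1 := by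
    filter_upwards [h] with y hy using by rw [hy, one_pow]
  have := hsq.deriv_eq
  rw [hf.hasDerivAt.norm_sq.deriv, deriv_const] at this
  linarith

theorem differentiableAt_deriv_of_contDiffAt {f : ℝ → F} {x : ℝ} (hf : ContDiffAt ℝ 2 f x) :
    DifferentiableAt ℝ (deriv f) x :=
  ((hf.fderiv_right (m := 1) (by norm_num)).differentiableAt one_ne_zero).clm_apply
    (differentiableAt_const 1)

theorem deriv_inv_norm {f : ℝ → E} {x : ℝ} (hf : DifferentiableAt ℝ f x) (h : f x ≠ 0) :
    deriv (fun y => ‖f y‖⁻¹) x = -(⟪f x, deriv f x⟫ / ‖f x‖ ^ 3) := by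
  have hpos : 0 < ‖f x‖ := norm_pos_iff.2 h
  have hsqrt := (hf.hasDerivAt.norm_sq.sqrt (pow_pos hpos 2).ne').fun_inv (by simpa using h)
  simp only [Real.sqrt_sq (norm_nonneg _)] at hsqrt
  rw [hsqrt.deriv]
  field_simp

theorem deriv_rpow_mul {f g : ℝ → ℝ} {x : ℝ} (r : ℝ) (hf : DifferentiableAt ℝ f x)
    (hpos : 0 < f x) (hg : DifferentiableAt ℝ g x) :
    deriv (fun y => f y ^ r * g y) x =
      f x ^ r * (deriv g x + r * deriv (fun y => Real.log (f y)) x * g x) := by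
  rw [deriv_fun_mul (hf.rpow_const (Or.inl hpos.ne')) hg,
    (hf.hasDerivAt.rpow_const (Or.inl hpos.ne')).deriv, deriv.log hf hpos.ne',
    Real.rpow_sub_one hpos.ne']
  ring

/-! ### The arc-length derivative -/

section ArcDeriv

variable {γ : ℝ → Plane} {p : ℝ}

theorem differentiableAt_arcDeriv {f : ℝ → F} (hγ : ContDiffAt ℝ 2 γ p)
    (hγ' : deriv γ p ≠ 0) (hf : ContDiffAt ℝ 2 f p) : DifferentiableAt ℝ (arcDeriv γ f) p :=
  (((differentiableAt_deriv_of_contDiffAt hγ).norm ℝ hγ').inv (norm_ne_zero_iff.2 hγ')).smul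
    (differentiableAt_deriv_of_contDiffAt hf)

theorem arcDeriv_congr {f g : ℝ → F} (h : f =ᶠ[𝓝 p] g) : arcDeriv γ f p = arcDeriv γ g p := by
  rw [arcDeriv, arcDeriv, h.deriv_eq]

theorem arcDeriv_add {f g : ℝ → F} (hf : DifferentiableAt ℝ f p) (hg : DifferentiableAt ℝ g p) :
    arcDeriv γ (fun q => f q + g q) p = arcDeriv γ f p + arcDeriv γ g p := by
  simp only [arcDeriv, deriv_fun_add hf hg, smul_add]

theorem arcDeriv_const_mul {f : ℝ → ℝ} (c : ℝ) :
    arcDeriv γ (fun q => c * f q) p = c * arcDeriv γ f p := by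
  rw [arcDeriv, arcDeriv, deriv_const_mul_field, smul_eq_mul, smul_eq_mul, mul_left_comm]

theorem arcDeriv_log {f : ℝ → ℝ} (hf : DifferentiableAt ℝ f p) (h : f p ≠ 0) :
    arcDeriv γ (fun q => Real.log (f q)) p = arcDeriv γ f p / f p := by
  rw [arcDeriv, arcDeriv, deriv.log hf h, smul_eq_mul, smul_eq_mul, mul_div_assoc]

theorem arcDeriv_smul {f : ℝ → ℝ} {g : ℝ → F} (hf : DifferentiableAt ℝ f p)
    (hg : DifferentiableAt ℝ g p) :
    arcDeriv γ (fun q => f q • g q) p = arcDeriv γ f p • g p + f p • arcDeriv γ g p := by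
  rw [arcDeriv, arcDeriv, arcDeriv, deriv_fun_smul hf hg]
  module

theorem arcDeriv_rpow_mul {f g : ℝ → ℝ} (r : ℝ) (hf : DifferentiableAt ℝ f p) (hpos : 0 < f p)
    (hg : DifferentiableAt ℝ g p) :
    arcDeriv γ (fun q => f q ^ r * g q) p =
      f p ^ r * (arcDeriv γ g p + r * arcDeriv γ (fun q => Real.log (f q)) p * g p) := by
  simp only [arcDeriv, deriv_rpow_mul r hf hpos hg, smul_eq_mul]
  ring

theorem arcDeriv_inner {f g : ℝ → E} (hf : DifferentiableAt ℝ f p)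
    (hg : DifferentiableAt ℝ g p) :
    arcDeriv γ (fun q => ⟪f q, g q⟫) p = ⟪arcDeriv γ f p, g p⟫ + ⟪f p, arcDeriv γ g p⟫ := by
  simp only [arcDeriv, deriv_inner_apply ℝ hf hg, real_inner_smul_left, real_inner_smul_right,
    smul_eq_mul]
  ring

theorem arcDeriv_inner_const_left {f : ℝ → E} (c : E) (hf : DifferentiableAt ℝ f p) :
    arcDeriv γ (fun q => ⟪c, f q⟫) p = ⟪c, arcDeriv γ f p⟫ := by
  simp only [arcDeriv, deriv_inner_apply ℝ (differentiableAt_const c) hf, deriv_const,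
    inner_zero_left, add_zero, real_inner_smul_right, smul_eq_mul]

theorem norm_arcDeriv_self (h : deriv γ p ≠ 0) : ‖arcDeriv γ γ p‖ = 1 := by
  rw [arcDeriv, norm_smul, norm_inv, norm_norm, inv_mul_cancel₀ (norm_ne_zero_iff.2 h)]

theorem inner_self_arcDeriv_eq_zero {f : ℝ → E} (hf : DifferentiableAt ℝ f p)
    (h : ∀ᶠ q in 𝓝 p, ‖f q‖ = 1) : ⟪f p, arcDeriv γ f p⟫ = 0 := by
  rw [arcDeriv, real_inner_smul_right, inner_self_deriv_eq_zero hf h, mul_zero]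

theorem arcDeriv_eq_zero_of_isLocalMax {f : ℝ → ℝ} (h : IsLocalMax f p) :
    arcDeriv γ f p = 0 := by
  rw [arcDeriv, h.deriv_eq_zero, smul_zero]

theorem arcDeriv_arcDeriv_nonpos_of_isLocalMax {f : ℝ → ℝ} (h : IsLocalMax f p)
    (hf : ContDiffAt ℝ 2 f p) (hγ : ContDiffAt ℝ 2 γ p) (hγ' : deriv γ p ≠ 0) :
    arcDeriv γ (arcDeriv γ f) p ≤ 0 := by
  have hinv : DifferentiableAt ℝ (fun q => ‖deriv γ q‖⁻¹) p :=
    ((differentiableAt_deriv_of_contDiffAt hγ).norm ℝ hγ').inv (norm_ne_zero_iff.2 hγ')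
  have hsmul : arcDeriv γ (arcDeriv γ f) p =
      ‖deriv γ p‖⁻¹ * (‖deriv γ p‖⁻¹ * deriv (deriv f) p) := by
    have hderiv : deriv (arcDeriv γ f) p = ‖deriv γ p‖⁻¹ * deriv (deriv f) p := by
      have := deriv_fun_smul hinv (differentiableAt_deriv_of_contDiffAt hf)
      rwa [h.deriv_eq_zero, smul_zero, add_zero] at this
    rw [arcDeriv, hderiv, smul_eq_mul]
  rw [hsmul]
  have := deriv_deriv_nonpos_of_isLocalMax h hf.continuousAt
  exact mul_nonpos_of_nonneg_of_nonpos (by positivity)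
    (mul_nonpos_of_nonneg_of_nonpos (by positivity) this)

end ArcDeriv

/-! ### The Frenet equation -/

theorem eq_inner_smul_of_inner_eq_zero {T n w : Plane} (hT : T ≠ 0) (hn : ‖n‖ = 1)
    (hTn : ⟪T, n⟫ = 0) (hTw : ⟪T, w⟫ = 0) : w = ⟪n, w⟫ • n := by
  have : Fact (Module.finrank ℝ Plane = 2) := ⟨finrank_euclideanSpace_fin⟩
  have hn0 : n ≠ 0 := norm_ne_zero_iff.1 (hn ▸ one_ne_zero)
  obtain ⟨c, rfl⟩ := Submodule.mem_span_singleton.1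
    (Submodule.mem_span_singleton_of_inner_eq_zero_of_inner_eq_zero hT hn0 hTw hTn)
  rw [real_inner_smul_right, real_inner_self_eq_norm_sq, hn, one_pow, mul_one]

theorem IsInwardUnitNormal.arcDeriv_arcDeriv_self {γ : ℝ → Plane} {p : ℝ} {n : Plane}
    (hn : IsInwardUnitNormal γ p n) (hγ : ContDiff ℝ 2 γ) (hγ' : ∀ q, deriv γ q ≠ 0) :
    arcDeriv γ (arcDeriv γ γ) p = curvature γ p • n := by
  have hT : DifferentiableAt ℝ (arcDeriv γ γ) p :=
    differentiableAt_arcDeriv hγ.contDiffAt (hγ' p) hγ.contDiffAt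
  have hTn : ⟪arcDeriv γ γ p, n⟫ = 0 := by
    rw [arcDeriv, real_inner_smul_left, real_inner_comm, hn.orthogonal, mul_zero]
  have hTs : ⟪arcDeriv γ γ p, arcDeriv γ (arcDeriv γ γ) p⟫ = 0 :=
    inner_self_arcDeriv_eq_zero hT (Eventually.of_forall fun q => norm_arcDeriv_self (hγ' q))
  have hcoeff : arcDeriv γ (arcDeriv γ γ) p = ⟪n, arcDeriv γ (arcDeriv γ γ) p⟫ • n :=
    eq_inner_smul_of_inner_eq_zero
      (norm_ne_zero_iff.1 ((norm_arcDeriv_self (hγ' p)).trans_ne one_ne_zero))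
      hn.norm_eq_one hTn hTs
  -- The curve lies on the side of its tangent line to which `n` points.
  have hmax : IsLocalMax (fun q => ⟪-n, γ q⟫) p := Eventually.of_forall fun q => by
    have := hn.inward q
    simp only [inner_sub_right, inner_neg_left] at this ⊢
    linarith
  have hTmax : arcDeriv γ (fun q => ⟪-n, γ q⟫) = fun q => ⟪-n, arcDeriv γ γ q⟫ :=
    funext fun q => arcDeriv_inner_const_left (-n) (hγ.differentiable two_ne_zero q)
  have hnonneg : 0 ≤ ⟪n, arcDeriv γ (arcDeriv γ γ) p⟫ := by
    have := arcDeriv_arcDeriv_nonpos_of_isLocalMax hmax (contDiffAt_const.inner ℝ hγ.contDiffAt)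
      hγ.contDiffAt (hγ' p)
    rw [hTmax, arcDeriv_inner_const_left (-n) hT, inner_neg_left] at this
    linarith
  have hcurvature : curvature γ p = ⟪n, arcDeriv γ (arcDeriv γ γ) p⟫ := by
    rw [curvature, hcoeff, norm_smul, hn.norm_eq_one, mul_one, ← hcoeff,
      Real.norm_of_nonneg hnonneg]
  rw [hcurvature]
  exact hcoeff

/-! ### Families of curves -/

/-- Smoothness, jointly in the parameter `p` and the time `t`, of a function `f p t` on the
space-time set `U`. -/
abbrev SmoothOn (U : Set (ℝ × ℝ)) (f : ℝ → ℝ → F) : Prop :=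
  ContDiffOn ℝ ∞ (Function.uncurry f) U

/-- The derivative of `f p t` in the parameter `p`. -/
noncomputable def paramDeriv (f : ℝ → ℝ → F) (p t : ℝ) : F := deriv (fun q => f q t) p

/-- The derivative `∂_t f` of `f p t` at a fixed parameter `p`. -/
noncomputable def timeDeriv (f : ℝ → ℝ → F) (p t : ℝ) : F := deriv (f p) t

/-- The derivative `∂_s f` of `f p t` with respect to the arc length of the curve `X · t`. -/
noncomputable def spaceDeriv (X : ℝ → ℝ → Plane) (f : ℝ → ℝ → F) (p t : ℝ) : F :=
  arcDeriv (fun q => X q t) (fun q => f q t) p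

theorem spaceDeriv_eq (X : ℝ → ℝ → Plane) (f : ℝ → ℝ → F) (p t : ℝ) :
    spaceDeriv X f p t = ‖paramDeriv X p t‖⁻¹ • paramDeriv f p t := rfl

section SmoothOn

variable {U : Set (ℝ × ℝ)} {f g : ℝ → ℝ → F} {p t : ℝ}

theorem SmoothOn.differentiableAt (hf : SmoothOn U f) (hU : IsOpen U) (hz : (p, t) ∈ U) :
    DifferentiableAt ℝ (Function.uncurry f) (p, t) :=
  (hf.contDiffAt (hU.mem_nhds hz)).differentiableAt (by simp)

theorem SmoothOn.contDiffAt_param (hf : SmoothOn U f) (hU : IsOpen U) (hz : (p, t) ∈ U) :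
    ContDiffAt ℝ ∞ (fun q => f q t) p :=
  (hf.contDiffAt (hU.mem_nhds hz)).comp (f := fun q : ℝ => (q, t)) p
    (contDiffAt_id.prodMk contDiffAt_const)

theorem SmoothOn.contDiffAt_time (hf : SmoothOn U f) (hU : IsOpen U) (hz : (p, t) ∈ U) :
    ContDiffAt ℝ ∞ (f p) t :=
  (hf.contDiffAt (hU.mem_nhds hz)).comp (f := fun τ : ℝ => (p, τ)) t
    (contDiffAt_const.prodMk contDiffAt_id)

theorem SmoothOn.differentiableAt_param (hf : SmoothOn U f) (hU : IsOpen U) (hz : (p, t) ∈ U) :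
    DifferentiableAt ℝ (fun q => f q t) p :=
  (hf.contDiffAt_param hU hz).differentiableAt (by simp)

theorem SmoothOn.differentiableAt_time (hf : SmoothOn U f) (hU : IsOpen U) (hz : (p, t) ∈ U) :
    DifferentiableAt ℝ (f p) t :=
  (hf.contDiffAt_time hU hz).differentiableAt (by simp)

theorem eventually_mem_param (hU : IsOpen U) (hz : (p, t) ∈ U) : ∀ᶠ q in 𝓝 p, (q, t) ∈ U :=
  (Continuous.prodMk_left t).continuousAt.eventually_mem (hU.mem_nhds hz)

theorem eventually_mem_time (hU : IsOpen U) (hz : (p, t) ∈ U) : ∀ᶠ τ in 𝓝 t, (p, τ) ∈ U :=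
  (Continuous.prodMk_right p).continuousAt.eventually_mem (hU.mem_nhds hz)

theorem SmoothOn.paramDeriv_eq_fderiv (hf : SmoothOn U f) (hU : IsOpen U) (hz : (p, t) ∈ U) :
    paramDeriv f p t = fderiv ℝ (Function.uncurry f) (p, t) (1, 0) :=
  ((hf.differentiableAt hU hz).hasFDerivAt.comp_hasDerivAt (f := fun q : ℝ => (q, t)) p
    ((hasDerivAt_id p).prodMk (hasDerivAt_const p t))).deriv

theorem SmoothOn.timeDeriv_eq_fderiv (hf : SmoothOn U f) (hU : IsOpen U) (hz : (p, t) ∈ U) :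
    timeDeriv f p t = fderiv ℝ (Function.uncurry f) (p, t) (0, 1) :=
  ((hf.differentiableAt hU hz).hasFDerivAt.comp_hasDerivAt (f := fun τ : ℝ => (p, τ)) t
    ((hasDerivAt_const t p).prodMk (hasDerivAt_id t))).deriv

theorem smoothOn_paramDeriv (hU : IsOpen U) (hf : SmoothOn U f) : SmoothOn U (paramDeriv f) :=
  ((hf.fderiv_of_isOpen hU (m := ∞) (by simp)).clm_apply contDiffOn_const).congr
    fun _ hz => hf.paramDeriv_eq_fderiv hU hz

theorem smoothOn_timeDeriv (hU : IsOpen U) (hf : SmoothOn U f) : SmoothOn U (timeDeriv f) :=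
  ((hf.fderiv_of_isOpen hU (m := ∞) (by simp)).clm_apply contDiffOn_const).congr
    fun _ hz => hf.timeDeriv_eq_fderiv hU hz

theorem timeDeriv_congr (hU : IsOpen U) (h : ∀ p t, (p, t) ∈ U → f p t = g p t)
    (hz : (p, t) ∈ U) : timeDeriv f p t = timeDeriv g p t :=
  EventuallyEq.deriv_eq ((eventually_mem_time hU hz).mono fun _ => h p _)

theorem spaceDeriv_congr {X : ℝ → ℝ → Plane} (hU : IsOpen U)
    (h : ∀ p t, (p, t) ∈ U → f p t = g p t) (hz : (p, t) ∈ U) :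
    spaceDeriv X f p t = spaceDeriv X g p t :=
  arcDeriv_congr ((eventually_mem_param hU hz).mono fun _ => h _ t)

theorem timeDeriv_paramDeriv (hU : IsOpen U) (hf : SmoothOn U f) (hz : (p, t) ∈ U) :
    timeDeriv (paramDeriv f) p t = paramDeriv (timeDeriv f) p t := by
  have hfderiv : DifferentiableAt ℝ (fderiv ℝ (Function.uncurry f)) (p, t) :=
    ((hf.fderiv_of_isOpen hU (m := ∞) (by simp)).contDiffAt (hU.mem_nhds hz)).differentiableAt
      (by simp)
  have hsymm : IsSymmSndFDerivAt ℝ (Function.uncurry f) (p, t) := by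
    refine (hf.contDiffAt (hU.mem_nhds hz)).isSymmSndFDerivAt ?_
    rw [minSmoothness_of_isRCLikeNormedField]
    exact WithTop.coe_le_coe.2 le_top
  have hsecond (v w : ℝ × ℝ) : fderiv ℝ (fun z => fderiv ℝ (Function.uncurry f) z v) (p, t) w =
      fderiv ℝ (fderiv ℝ (Function.uncurry f)) (p, t) w v := by
    rw [fderiv_clm_apply hfderiv (differentiableAt_const v)]
    simp
  have hparam : Function.uncurry (paramDeriv f) =ᶠ[𝓝 (p, t)]
      fun z => fderiv ℝ (Function.uncurry f) z (1, 0) :=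
    eventually_of_mem (hU.mem_nhds hz) fun _ hy => hf.paramDeriv_eq_fderiv hU hy
  have htime : Function.uncurry (timeDeriv f) =ᶠ[𝓝 (p, t)]
      fun z => fderiv ℝ (Function.uncurry f) z (0, 1) :=
    eventually_of_mem (hU.mem_nhds hz) fun _ hy => hf.timeDeriv_eq_fderiv hU hy
  rw [(smoothOn_paramDeriv hU hf).timeDeriv_eq_fderiv hU hz,
    (smoothOn_timeDeriv hU hf).paramDeriv_eq_fderiv hU hz, hparam.fderiv_eq,
    htime.fderiv_eq, hsecond, hsecond, hsymm]

theorem timeDeriv_inner {f g : ℝ → ℝ → E} (hU : IsOpen U) (hf : SmoothOn U f)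
    (hg : SmoothOn U g) (hz : (p, t) ∈ U) :
    timeDeriv (fun p t => ⟪f p t, g p t⟫) p t =
      ⟪f p t, timeDeriv g p t⟫ + ⟪timeDeriv f p t, g p t⟫ :=
  deriv_inner_apply ℝ (hf.differentiableAt_time hU hz) (hg.differentiableAt_time hU hz)

theorem timeDeriv_rpow_mul {f g : ℝ → ℝ → ℝ} (r : ℝ) (hU : IsOpen U) (hf : SmoothOn U f)
    (hpos : 0 < f p t) (hg : SmoothOn U g) (hz : (p, t) ∈ U) :
    timeDeriv (fun p t => f p t ^ r * g p t) p t = f p t ^ r *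
      (timeDeriv g p t + r * timeDeriv (fun p t => Real.log (f p t)) p t * g p t) :=
  deriv_rpow_mul r (hf.differentiableAt_time hU hz) hpos (hg.differentiableAt_time hU hz)

theorem inner_self_timeDeriv_eq_zero {f : ℝ → ℝ → E} (hU : IsOpen U) (hf : SmoothOn U f)
    (hnorm : ∀ p t, (p, t) ∈ U → ‖f p t‖ = 1) (hz : (p, t) ∈ U) :
    ⟪f p t, timeDeriv f p t⟫ = 0 :=
  inner_self_deriv_eq_zero (f := f p) (hf.differentiableAt_time hU hz)
    ((eventually_mem_time hU hz).mono fun τ => hnorm p τ)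

variable {X : ℝ → ℝ → Plane}

theorem spaceDeriv_add (hU : IsOpen U) (hf : SmoothOn U f) (hg : SmoothOn U g)
    (hz : (p, t) ∈ U) :
    spaceDeriv X (fun p t => f p t + g p t) p t = spaceDeriv X f p t + spaceDeriv X g p t :=
  arcDeriv_add (hf.differentiableAt_param hU hz) (hg.differentiableAt_param hU hz)

theorem spaceDeriv_const_mul {f : ℝ → ℝ → ℝ} (c : ℝ) :
    spaceDeriv X (fun p t => c * f p t) p t = c * spaceDeriv X f p t :=
  arcDeriv_const_mul c

theorem spaceDeriv_log {f : ℝ → ℝ → ℝ} (hU : IsOpen U) (hf : SmoothOn U f) (hpos : 0 < f p t)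
    (hz : (p, t) ∈ U) :
    spaceDeriv X (fun p t => Real.log (f p t)) p t = spaceDeriv X f p t / f p t :=
  arcDeriv_log (hf.differentiableAt_param hU hz) hpos.ne'

theorem spaceDeriv_mul {f g : ℝ → ℝ → ℝ} (hU : IsOpen U) (hf : SmoothOn U f) (hg : SmoothOn U g)
    (hz : (p, t) ∈ U) :
    spaceDeriv X (fun p t => f p t * g p t) p t =
      spaceDeriv X f p t * g p t + f p t * spaceDeriv X g p t :=
  arcDeriv_smul (hf.differentiableAt_param hU hz) (hg.differentiableAt_param hU hz)

theorem spaceDeriv_sq {f : ℝ → ℝ → ℝ} (hU : IsOpen U) (hf : SmoothOn U f) (hz : (p, t) ∈ U) :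
    spaceDeriv X (fun p t => f p t ^ 2) p t = 2 * f p t * spaceDeriv X f p t := by
  simp only [pow_two]
  rw [spaceDeriv_mul hU hf hf hz]
  ring

theorem spaceDeriv_smul {f : ℝ → ℝ → ℝ} (hU : IsOpen U) (hf : SmoothOn U f) (hg : SmoothOn U g)
    (hz : (p, t) ∈ U) :
    spaceDeriv X (fun p t => f p t • g p t) p t =
      spaceDeriv X f p t • g p t + f p t • spaceDeriv X g p t :=
  arcDeriv_smul (hf.differentiableAt_param hU hz) (hg.differentiableAt_param hU hz)

theorem spaceDeriv_inner {f g : ℝ → ℝ → E} (hU : IsOpen U) (hf : SmoothOn U f)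
    (hg : SmoothOn U g) (hz : (p, t) ∈ U) :
    spaceDeriv X (fun p t => ⟪f p t, g p t⟫) p t =
      ⟪spaceDeriv X f p t, g p t⟫ + ⟪f p t, spaceDeriv X g p t⟫ :=
  arcDeriv_inner (hf.differentiableAt_param hU hz) (hg.differentiableAt_param hU hz)

theorem spaceDeriv_rpow_mul {f g : ℝ → ℝ → ℝ} (r : ℝ) (hU : IsOpen U) (hf : SmoothOn U f)
    (hpos : 0 < f p t) (hg : SmoothOn U g) (hz : (p, t) ∈ U) :
    spaceDeriv X (fun p t => f p t ^ r * g p t) p t = f p t ^ r *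
      (spaceDeriv X g p t + r * spaceDeriv X (fun p t => Real.log (f p t)) p t * g p t) :=
  arcDeriv_rpow_mul r (hf.differentiableAt_param hU hz) hpos (hg.differentiableAt_param hU hz)

theorem inner_self_spaceDeriv_eq_zero {f : ℝ → ℝ → E} (hU : IsOpen U) (hf : SmoothOn U f)
    (hnorm : ∀ p t, (p, t) ∈ U → ‖f p t‖ = 1) (hz : (p, t) ∈ U) :
    ⟪f p t, spaceDeriv X f p t⟫ = 0 :=
  inner_self_arcDeriv_eq_zero (f := fun q => f q t) (hf.differentiableAt_param hU hz)
    ((eventually_mem_param hU hz).mono fun q => hnorm q t)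

end SmoothOn

/-- On the open space-time set `U`, the maps `X · t` are smooth regular parametrizations of plane
curves, depending smoothly on `t`. -/
structure IsRegularFamily (U : Set (ℝ × ℝ)) (X : ℝ → ℝ → Plane) : Prop where
  isOpen : IsOpen U
  smooth : SmoothOn U X
  regular : ∀ p t, (p, t) ∈ U → paramDeriv X p t ≠ 0

namespace IsRegularFamily

variable {U : Set (ℝ × ℝ)} {X : ℝ → ℝ → Plane} {f : ℝ → ℝ → F} {p t : ℝ}

theorem smoothOn_spaceDeriv (h : IsRegularFamily U X) (hf : SmoothOn U f) :
    SmoothOn U (spaceDeriv X f) :=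
  (((smoothOn_paramDeriv h.isOpen h.smooth).norm ℝ fun z hz => h.regular z.1 z.2 hz).inv
    fun z hz => norm_ne_zero_iff.2 (h.regular z.1 z.2 hz)).smul (smoothOn_paramDeriv h.isOpen hf)

theorem timeDeriv_spaceDeriv (h : IsRegularFamily U X) (hf : SmoothOn U f) (hz : (p, t) ∈ U) :
    timeDeriv (spaceDeriv X f) p t = spaceDeriv X (timeDeriv f) p t -
      ⟪spaceDeriv X (timeDeriv X) p t, spaceDeriv X X p t⟫ • spaceDeriv X f p t := by
  have hX' := (smoothOn_paramDeriv h.isOpen h.smooth).differentiableAt_time h.isOpen hz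
  have hv := h.regular p t hz
  have hpos : 0 < ‖paramDeriv X p t‖ := norm_pos_iff.2 hv
  have hinv : DifferentiableAt ℝ (fun τ => ‖paramDeriv X p τ‖⁻¹) t :=
    (hX'.norm ℝ hv).inv hpos.ne'
  calc timeDeriv (spaceDeriv X f) p t
      = deriv (fun τ => ‖paramDeriv X p τ‖⁻¹ • paramDeriv f p τ) t := rfl
    _ = ‖paramDeriv X p t‖⁻¹ • timeDeriv (paramDeriv f) p t -
        (⟪paramDeriv X p t, timeDeriv (paramDeriv X) p t⟫ / ‖paramDeriv X p t‖ ^ 3) •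
          paramDeriv f p t := by
      rw [deriv_fun_smul hinv ((smoothOn_paramDeriv h.isOpen hf).differentiableAt_time h.isOpen hz),
        deriv_inv_norm hX' hv, neg_smul, ← sub_eq_add_neg]
      rfl
    _ = _ := by
      rw [timeDeriv_paramDeriv h.isOpen h.smooth hz, timeDeriv_paramDeriv h.isOpen hf hz]
      simp only [spaceDeriv_eq, smul_smul, real_inner_smul_left, real_inner_smul_right]
      rw [real_inner_comm]
      congr 2
      field_simp

end IsRegularFamily

/-! ### Parabolic maxima -/

/-- Up to time `t` and near `(p, t)`, the function `(t - a) f²` is maximal at `(p, t)`. -/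
def IsParabolicMax (a : ℝ) (f : ℝ → ℝ → ℝ) (p t : ℝ) : Prop :=
  IsLocalMaxOn (fun z : ℝ × ℝ => (z.2 - a) * f z.1 z.2 ^ 2) {z | z.2 ≤ t} (p, t)

namespace IsParabolicMax

variable {U : Set (ℝ × ℝ)} {X : ℝ → ℝ → Plane} {f : ℝ → ℝ → ℝ} {a p t : ℝ}

theorem isLocalMax_mul_apply (h : IsParabolicMax a f p t) (hat : a < t) :
    IsLocalMax (fun q => f p t * f q t) p := by
  have htendsto : Tendsto (fun q : ℝ => (q, t)) (𝓝 p) (𝓝[{z | z.2 ≤ t}] (p, t)) :=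
    tendsto_nhdsWithin_iff.2
      ⟨(Continuous.prodMk_left t).continuousAt, Eventually.of_forall fun _ => le_refl t⟩
  filter_upwards [htendsto.eventually h] with q hq
  have hsq : f q t ^ 2 ≤ f p t ^ 2 := le_of_mul_le_mul_left hq (sub_pos.2 hat)
  nlinarith [sq_nonneg (f p t - f q t)]

theorem spaceDeriv_eq_zero (h : IsParabolicMax a f p t) (hat : a < t) (hf : f p t ≠ 0) :
    spaceDeriv X f p t = 0 := by
  have hzero : spaceDeriv X (fun p' t' => f p t * f p' t') p t = 0 :=
    arcDeriv_eq_zero_of_isLocalMax (h.isLocalMax_mul_apply hat)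
  rw [spaceDeriv_const_mul] at hzero
  exact (mul_eq_zero.1 hzero).resolve_left hf

theorem mul_spaceDeriv_spaceDeriv_nonpos (h : IsParabolicMax a f p t) (hat : a < t)
    (hX : IsRegularFamily U X) (hf : SmoothOn U f) (hz : (p, t) ∈ U) :
    f p t * spaceDeriv X (spaceDeriv X f) p t ≤ 0 := by
  have hderiv : spaceDeriv X (fun p' t' => f p t * f p' t') =
      fun p' t' => f p t * spaceDeriv X f p' t' :=
    funext₂ fun _ _ => spaceDeriv_const_mul _
  have two_le : (2 : WithTop ℕ∞) ≤ ∞ := WithTop.coe_le_coe.2 le_top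
  have hnonpos : spaceDeriv X (spaceDeriv X fun p' t' => f p t * f p' t') p t ≤ 0 :=
    arcDeriv_arcDeriv_nonpos_of_isLocalMax (h.isLocalMax_mul_apply hat)
      (contDiffAt_const.mul ((hf.contDiffAt_param hX.isOpen hz).of_le two_le))
      ((hX.smooth.contDiffAt_param hX.isOpen hz).of_le two_le) (hX.regular p t hz)
  rwa [hderiv, spaceDeriv_const_mul] at hnonpos

theorem time_deriv_nonneg (h : IsParabolicMax a f p t) (hU : IsOpen U) (hf : SmoothOn U f)
    (hz : (p, t) ∈ U) : 0 ≤ f p t ^ 2 + 2 * (t - a) * (f p t * timeDeriv f p t) := by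
  have htendsto : Tendsto (fun τ : ℝ => (p, τ)) (𝓝[Iic t] t) (𝓝[{z | z.2 ≤ t}] (p, t)) :=
    tendsto_nhdsWithin_iff.2 ⟨(Continuous.prodMk_right p).continuousWithinAt,
      eventually_mem_nhdsWithin⟩
  have hmax : IsLocalMaxOn (fun τ => (τ - a) * f p τ ^ 2) (Iic t) t := htendsto.eventually h
  have hf' : HasDerivAt (f p) (timeDeriv f p t) t :=
    (hf.differentiableAt_time hU hz).hasDerivAt
  have hderiv : HasDerivAt (fun τ => (τ - a) * f p τ ^ 2)
      (1 * f p t ^ 2 + (t - a) * (↑2 * f p t ^ (2 - 1) * timeDeriv f p t)) t :=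
    ((hasDerivAt_id t).sub_const a).mul (hf'.pow 2)
  refine (deriv_nonneg_of_isLocalMaxOn_Iic hmax hderiv).trans_eq ?_
  push_cast
  ring

end IsParabolicMax

/-- The first and second order conditions at an interior maximum of `(t - a) (e v)²`, where `v`
solves `v_t = a₂ (v_ss + b q v_s + (D - c q²) v)`. Here `τ = t - a`. -/
theorem mul_sq_add_le_of_max {e e₁ e₂ eₜ v v₁ v₂ vₜ q a b c D τ : ℝ} (ha : 0 < a) (hτ : 0 < τ)
    (hv : v ≠ 0) (hspace : e₁ * v + e * v₁ = 0)
    (hsecond : e * v * (e₂ * v + 2 * e₁ * v₁ + e * v₂) ≤ 0)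
    (htime : 0 ≤ (e * v) ^ 2 + 2 * τ * (e * v * (eₜ * v + e * vₜ)))
    (heq : vₜ = a * (v₂ + b * q * v₁ + (D - c * q ^ 2) * v)) :
    c * (e * q) ^ 2 + b * e₁ * (e * q) ≤
      2 * e₁ ^ 2 - e * e₂ + D * e ^ 2 + e * eₜ / a + e ^ 2 / (2 * τ * a) := by
  have hv₁ : e * v₁ = -(e₁ * v) := by linarith
  have htime' : 0 ≤ e ^ 2 * v ^ 2 / (2 * τ * a) +
      e * v * (eₜ * v / a + e * (v₂ + b * q * v₁ + (D - c * q ^ 2) * v)) := by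
    rw [heq] at htime
    calc 0 ≤ _ := div_nonneg htime (by positivity : 0 ≤ 2 * τ * a)
      _ = _ := by
        field_simp
  refine le_of_mul_le_mul_right ?_ (sq_pos_of_ne_zero hv)
  have h1 : e * v * (2 * e₁ * v₁) = -2 * e₁ ^ 2 * v ^ 2 := by linear_combination 2 * e₁ * v * hv₁
  have h2 : e * v * e * (b * q * v₁) = - b * q * e * e₁ * v ^ 2 := by
    linear_combination b * q * e * v * hv₁
  have h3 : (e * eₜ / a + e ^ 2 / (2 * τ * a)) * v ^ 2 =
    e ^ 2 * v ^ 2 / (2 * τ * a) + e * v * (eₜ * v / a) := by ring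
  linarith

theorem mul_sq_le_of_mul_sq_le_add {A B c x : ℝ} (hc : 0 < c) (h : c * x ^ 2 ≤ A * x + B) :
    c * x ^ 2 ≤ A ^ 2 / c + 2 * B := by
  have hyoung : 2 * (A * x) ≤ c * x ^ 2 + A ^ 2 / c := by
    have hsq : c * x ^ 2 + A ^ 2 / c - 2 * (A * x) = (c * x - A) ^ 2 / c := by
      field_simp
      ring
    have : 0 ≤ (c * x - A) ^ 2 / c := by positivity
    linarith
  linarith

theorem mul_mul_sq_le_of_mul_sq_le {α τ c A B e k q u w V W : ℝ} (hα : 0 < α) (hτ : 0 < τ)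
    (hu : u ≠ 0) (hw : 0 ≤ w) (hwW : w ≤ W) (hAB : A ≤ B) (hB : 0 ≤ B) (hV : 0 ≤ V)
    (hkV : k / u * w ^ 2 ≤ V)
    (h : c * (e * q) ^ 2 ≤ A + 2 * (k / (2 * τ * (α * u)))) :
    c * (τ * (e * (w * q)) ^ 2) ≤ (B * W ^ 2 + α⁻¹ * V) * (1 + τ) := by
  calc c * (τ * (e * (w * q)) ^ 2)
      = τ * w ^ 2 * (c * (e * q) ^ 2) := by ring
    _ ≤ τ * w ^ 2 * (A + 2 * (k / (2 * τ * (α * u)))) := by gcongr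
    _ = A * w ^ 2 * τ + α⁻¹ * (k / u * w ^ 2) := by field_simp
    _ ≤ B * W ^ 2 * τ + α⁻¹ * V := by gcongr
    _ ≤ (B * W ^ 2 + α⁻¹ * V) * (1 + τ) := by
      linarith [show 0 ≤ B * W ^ 2 + α⁻¹ * V * τ by positivity]

/-! ### The evolution equations -/

/-- The curvature `κ` of the curve `X · t`, as a function of `p` and `t`. -/
noncomputable def familyCurvature (X : ℝ → ℝ → Plane) (p t : ℝ) : ℝ :=
  curvature (fun q => X q t) p

/-- The unit normal `κ⁻¹ ∂_s ∂_s X`, which is the inward one on a convex curve; it takes the junk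
value `0` where `κ = 0`. -/
noncomputable def principalNormal (X : ℝ → ℝ → Plane) (p t : ℝ) : Plane :=
  (familyCurvature X p t)⁻¹ • spaceDeriv X (spaceDeriv X X) p t

/-- On the space-time set `U`, the curves `X · t` have positive curvature and solve the `α`-curve
shortening flow. -/
structure IsCurvedFlow (α : ℝ) (U : Set (ℝ × ℝ)) (X : ℝ → ℝ → Plane) : Prop
    extends IsRegularFamily U X where
  curvature_pos : ∀ p t, (p, t) ∈ U → 0 < familyCurvature X p t
  flow : ∀ p t, (p, t) ∈ U → timeDeriv X p t = speed α X p t • principalNormal X p t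

/-- The logarithmic slope `∂_s log u` of the speed. -/
noncomputable def logSlope (α : ℝ) (X : ℝ → ℝ → Plane) : ℝ → ℝ → ℝ :=
  spaceDeriv X fun p t => Real.log (speed α X p t)

/-- The weighted slope `u^{-β} ∂_s u` of the speed, written as `u^{1-β} ∂_s log u`. -/
noncomputable def weightedSlope (α β : ℝ) (X : ℝ → ℝ → Plane) (p t : ℝ) : ℝ :=
  speed α X p t ^ (1 - β) * logSlope α X p t

/-- The coefficient `α κ^{α-1}` of `∂_s ∂_s` in the evolution equations, as a function of `u`. -/
noncomputable def diffusivity (α : ℝ) (X : ℝ → ℝ → Plane) (p t : ℝ) : ℝ :=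
  α * speed α X p t ^ (1 - α⁻¹)

/-- The localizing function `r² - |X|²`. -/
noncomputable def cutoff (r : ℝ) (X : ℝ → ℝ → Plane) (p t : ℝ) : ℝ :=
  r ^ 2 - ‖X p t‖ ^ 2

/-- The quantity `(r² - |X|²) u^{-β} ∂_s u` to which the maximum principle is applied. -/
noncomputable def localizedSlope (α β r : ℝ) (X : ℝ → ℝ → Plane) (p t : ℝ) : ℝ :=
  cutoff r X p t * weightedSlope α β X p t

theorem cutoff_nonneg {r p t : ℝ} {X : ℝ → ℝ → Plane} (h : ‖X p t‖ ≤ r) : 0 ≤ cutoff r X p t :=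
  sub_nonneg.2 (pow_le_pow_left₀ (norm_nonneg _) h 2)

theorem cutoff_le_one {r p t : ℝ} {X : ℝ → ℝ → Plane} (hr : r ≤ 1) (h : ‖X p t‖ ≤ r) :
    cutoff r X p t ≤ 1 :=
  (sub_le_self _ (sq_nonneg _)).trans (pow_le_one₀ ((norm_nonneg _).trans h) hr)

namespace IsCurvedFlow

variable {α β a r p t : ℝ} {U : Set (ℝ × ℝ)} {X : ℝ → ℝ → Plane}

local notation "∂ₛ" => spaceDeriv X
local notation "∂ₜ" => timeDeriv
local notation "𝐓" => spaceDeriv X X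
local notation "𝐍" => principalNormal X
local notation "κ" => familyCurvature X

theorem speed_pos (h : IsCurvedFlow α U X) (hz : (p, t) ∈ U) : 0 < speed α X p t :=
  Real.rpow_pos_of_pos (h.curvature_pos p t hz) α

theorem smoothOn_tangent (h : IsCurvedFlow α U X) : SmoothOn U (∂ₛ X) :=
  h.smoothOn_spaceDeriv h.smooth

theorem smoothOn_curvature (h : IsCurvedFlow α U X) : SmoothOn U κ :=
  (h.smoothOn_spaceDeriv h.smoothOn_tangent).norm ℝ fun z hz =>
    norm_pos_iff.1 (h.curvature_pos z.1 z.2 hz)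

theorem smoothOn_normal (h : IsCurvedFlow α U X) : SmoothOn U 𝐍 :=
  (h.smoothOn_curvature.inv fun z hz => (h.curvature_pos z.1 z.2 hz).ne').smul
    (h.smoothOn_spaceDeriv h.smoothOn_tangent)

theorem smoothOn_speed (h : IsCurvedFlow α U X) : SmoothOn U (speed α X) :=
  h.smoothOn_curvature.rpow_const_of_ne fun z hz => (h.curvature_pos z.1 z.2 hz).ne'

theorem smoothOn_log_speed (h : IsCurvedFlow α U X) :
    SmoothOn U fun p t => Real.log (speed α X p t) :=
  h.smoothOn_speed.log fun _ hz => (h.speed_pos hz).ne'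

theorem smoothOn_logSlope (h : IsCurvedFlow α U X) : SmoothOn U (logSlope α X) :=
  h.smoothOn_spaceDeriv h.smoothOn_log_speed

theorem norm_tangent (h : IsCurvedFlow α U X) (hz : (p, t) ∈ U) : ‖𝐓 p t‖ = 1 :=
  norm_arcDeriv_self (h.regular p t hz)

theorem norm_normal (h : IsCurvedFlow α U X) (hz : (p, t) ∈ U) : ‖𝐍 p t‖ = 1 := by
  have hpos := h.curvature_pos p t hz
  rw [principalNormal, norm_smul, Real.norm_of_nonneg (inv_nonneg.2 hpos.le)]
  exact inv_mul_cancel₀ hpos.ne'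

theorem spaceDeriv_tangent (h : IsCurvedFlow α U X) (hz : (p, t) ∈ U) :
    ∂ₛ 𝐓 p t = κ p t • 𝐍 p t := by
  rw [principalNormal, smul_inv_smul₀ (h.curvature_pos p t hz).ne']

theorem inner_tangent_normal (h : IsCurvedFlow α U X) (hz : (p, t) ∈ U) :
    ⟪𝐓 p t, 𝐍 p t⟫ = 0 := by
  rw [principalNormal, real_inner_smul_right, inner_self_spaceDeriv_eq_zero h.isOpen
    h.smoothOn_tangent (fun _ _ hz => h.norm_tangent hz) hz, mul_zero]

theorem spaceDeriv_normal (h : IsCurvedFlow α U X) (hz : (p, t) ∈ U) :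
    ∂ₛ 𝐍 p t = -(κ p t • 𝐓 p t) := by
  have hN := h.norm_normal hz
  have horth : ⟪𝐍 p t, ∂ₛ 𝐍 p t⟫ = 0 := inner_self_spaceDeriv_eq_zero h.isOpen
    h.smoothOn_normal (fun _ _ hz => h.norm_normal hz) hz
  have hconst : ∂ₛ (fun p t => ⟪𝐓 p t, 𝐍 p t⟫) p t = 0 := by
    rw [spaceDeriv_congr (g := fun _ _ => (0 : ℝ)) h.isOpen
      (fun p t hz => h.inner_tangent_normal hz) hz, spaceDeriv, arcDeriv, deriv_const, smul_zero]
  have hcoeff : ⟪𝐓 p t, ∂ₛ 𝐍 p t⟫ = -κ p t := by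
    rw [spaceDeriv_inner h.isOpen h.smoothOn_tangent h.smoothOn_normal hz,
      h.spaceDeriv_tangent hz, real_inner_smul_left, real_inner_self_eq_norm_sq, hN] at hconst
    linarith
  have hspan : ∂ₛ 𝐍 p t = ⟪𝐓 p t, ∂ₛ 𝐍 p t⟫ • 𝐓 p t :=
    eq_inner_smul_of_inner_eq_zero (norm_ne_zero_iff.1 (hN.trans_ne one_ne_zero))
      (h.norm_tangent hz) (by rw [real_inner_comm, h.inner_tangent_normal hz]) horth
  rw [hspan, hcoeff, neg_smul]

theorem spaceDeriv_velocity (h : IsCurvedFlow α U X) (hz : (p, t) ∈ U) :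
    ∂ₛ (∂ₜ X) p t = ∂ₛ (speed α X) p t • 𝐍 p t -
      (speed α X p t * κ p t) • 𝐓 p t := by
  rw [spaceDeriv_congr h.isOpen h.flow hz,
    spaceDeriv_smul h.isOpen h.smoothOn_speed h.smoothOn_normal hz, h.spaceDeriv_normal hz,
    smul_neg, smul_smul, ← sub_eq_add_neg]

theorem timeDeriv_spaceDeriv (h : IsCurvedFlow α U X) {f : ℝ → ℝ → F} (hf : SmoothOn U f)
    (hz : (p, t) ∈ U) :
    ∂ₜ (∂ₛ f) p t = ∂ₛ (∂ₜ f) p t +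
      (speed α X p t * κ p t) • ∂ₛ f p t := by
  have hinner : ⟪∂ₛ (∂ₜ X) p t, 𝐓 p t⟫ = -(speed α X p t * κ p t) := by
    rw [h.spaceDeriv_velocity hz, inner_sub_left, real_inner_smul_left, real_inner_smul_left,
      real_inner_comm, h.inner_tangent_normal hz, real_inner_self_eq_norm_sq, h.norm_tangent hz]
    ring
  rw [h.toIsRegularFamily.timeDeriv_spaceDeriv hf hz, hinner, neg_smul, sub_neg_eq_add]

theorem timeDeriv_tangent (h : IsCurvedFlow α U X) (hz : (p, t) ∈ U) :
    ∂ₜ 𝐓 p t = ∂ₛ (speed α X) p t • 𝐍 p t := by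
  rw [h.timeDeriv_spaceDeriv h.smooth hz, h.spaceDeriv_velocity hz, sub_add_cancel]

theorem timeDeriv_spaceDeriv_tangent (h : IsCurvedFlow α U X) (hz : (p, t) ∈ U) :
    ∂ₜ (∂ₛ 𝐓) p t =
      (∂ₛ (∂ₛ (speed α X)) p t + κ p t ^ 2 * speed α X p t) • 𝐍 p t -
        (∂ₛ (speed α X) p t * κ p t) • 𝐓 p t := by
  rw [h.timeDeriv_spaceDeriv h.smoothOn_tangent hz,
    spaceDeriv_congr h.isOpen (fun _ _ hz => h.timeDeriv_tangent hz) hz,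
    spaceDeriv_smul h.isOpen (h.smoothOn_spaceDeriv h.smoothOn_speed) h.smoothOn_normal hz,
    h.spaceDeriv_normal hz, h.spaceDeriv_tangent hz]
  module

theorem timeDeriv_curvature (h : IsCurvedFlow α U X) (hz : (p, t) ∈ U) :
    ∂ₜ κ p t = ∂ₛ (∂ₛ (speed α X)) p t + κ p t ^ 2 * speed α X p t := by
  have hNN : ⟪𝐍 p t, 𝐍 p t⟫ = 1 := by rw [real_inner_self_eq_norm_sq, h.norm_normal hz, one_pow]
  have hNT : ⟪𝐍 p t, 𝐓 p t⟫ = 0 := by rw [real_inner_comm, h.inner_tangent_normal hz]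
  have hNt : ⟪∂ₜ 𝐍 p t, 𝐍 p t⟫ = 0 := by
    rw [real_inner_comm]
    exact inner_self_timeDeriv_eq_zero h.isOpen h.smoothOn_normal
      (fun _ _ hz => h.norm_normal hz) hz
  have hκ (p t : ℝ) (hz : (p, t) ∈ U) : κ p t = ⟪𝐍 p t, ∂ₛ 𝐓 p t⟫ := by
    rw [h.spaceDeriv_tangent hz, real_inner_smul_right, real_inner_self_eq_norm_sq,
      h.norm_normal hz, one_pow, mul_one]
  rw [timeDeriv_congr h.isOpen hκ hz, timeDeriv_inner h.isOpen h.smoothOn_normal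
    (h.smoothOn_spaceDeriv h.smoothOn_tangent) hz, h.timeDeriv_spaceDeriv_tangent hz,
    h.spaceDeriv_tangent hz, inner_sub_right]
  simp only [real_inner_smul_right, hNN, hNT, hNt]
  ring

theorem spaceDeriv_speed (h : IsCurvedFlow α U X) (hz : (p, t) ∈ U) :
    ∂ₛ (speed α X) p t = speed α X p t * logSlope α X p t := by
  have hpos := h.speed_pos hz
  rw [logSlope, spaceDeriv_log h.isOpen h.smoothOn_speed hpos hz, mul_div_cancel₀ _ hpos.ne']

theorem spaceDeriv_spaceDeriv_speed (h : IsCurvedFlow α U X) (hz : (p, t) ∈ U) :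
    ∂ₛ (∂ₛ (speed α X)) p t =
      speed α X p t * (∂ₛ (logSlope α X) p t + logSlope α X p t ^ 2) := by
  rw [spaceDeriv_congr h.isOpen (fun _ _ hz => h.spaceDeriv_speed hz) hz,
    spaceDeriv_mul h.isOpen h.smoothOn_speed h.smoothOn_logSlope hz, h.spaceDeriv_speed hz]
  ring

theorem speed_rpow_inv (h : IsCurvedFlow α U X) (hα : α ≠ 0) (hz : (p, t) ∈ U) :
    speed α X p t ^ α⁻¹ = κ p t :=
  Real.rpow_rpow_inv (h.curvature_pos p t hz).le hα

theorem diffusivity_mul_curvature (h : IsCurvedFlow α U X) (hα : α ≠ 0) (hz : (p, t) ∈ U) :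
    diffusivity α X p t * κ p t = α * speed α X p t := by
  rw [diffusivity, ← h.speed_rpow_inv hα hz, mul_assoc, ← Real.rpow_add (h.speed_pos hz),
    sub_add_cancel, Real.rpow_one]

theorem log_speed (h : IsCurvedFlow α U X) (hz : (p, t) ∈ U) :
    Real.log (speed α X p t) = α * Real.log (κ p t) :=
  Real.log_rpow (h.curvature_pos p t hz) α

theorem spaceDeriv_curvature (h : IsCurvedFlow α U X) (hα : α ≠ 0) (hz : (p, t) ∈ U) :
    ∂ₛ κ p t = α⁻¹ * κ p t * logSlope α X p t := by
  have hpos := h.curvature_pos p t hz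
  rw [logSlope, spaceDeriv_congr h.isOpen (fun _ _ hz => h.log_speed hz) hz, spaceDeriv_const_mul,
    spaceDeriv_log h.isOpen h.smoothOn_curvature hpos hz]
  field_simp

theorem timeDeriv_log_speed (h : IsCurvedFlow α U X) (hα : α ≠ 0) (hz : (p, t) ∈ U) :
    ∂ₜ (fun p t => Real.log (speed α X p t)) p t = diffusivity α X p t *
      (∂ₛ (logSlope α X) p t + logSlope α X p t ^ 2 + κ p t ^ 2) := by
  have hpos := h.curvature_pos p t hz
  calc ∂ₜ (fun p t => Real.log (speed α X p t)) p t
      = ∂ₜ (fun p t => α * Real.log (κ p t)) p t :=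
        timeDeriv_congr h.isOpen (fun _ _ hz => h.log_speed hz) hz
    _ = α * (∂ₜ κ p t / κ p t) := by
      rw [timeDeriv, deriv_const_mul_field,
        deriv.log (h.smoothOn_curvature.differentiableAt_time h.isOpen hz) hpos.ne']
      rfl
    _ = α * speed α X p t / κ p t *
        (∂ₛ (logSlope α X) p t + logSlope α X p t ^ 2 + κ p t ^ 2) := by
      rw [h.timeDeriv_curvature hz, h.spaceDeriv_spaceDeriv_speed hz]
      ring
    _ = _ := by rw [← h.diffusivity_mul_curvature hα hz, mul_div_cancel_right₀ _ hpos.ne']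

theorem smoothOn_spaceDeriv_logSlope_add_sq (h : IsCurvedFlow α U X) :
    SmoothOn U fun p t => ∂ₛ (logSlope α X) p t + logSlope α X p t ^ 2 + κ p t ^ 2 :=
  ((h.smoothOn_spaceDeriv h.smoothOn_logSlope).add (h.smoothOn_logSlope.pow 2)).add
    (h.smoothOn_curvature.pow 2)

theorem spaceDeriv_spaceDeriv_logSlope_add_sq (h : IsCurvedFlow α U X) (hα : α ≠ 0)
    (hz : (p, t) ∈ U) :
    ∂ₛ (fun p t => ∂ₛ (logSlope α X) p t + logSlope α X p t ^ 2 + κ p t ^ 2) p t =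
      ∂ₛ (∂ₛ (logSlope α X)) p t + 2 * logSlope α X p t * ∂ₛ (logSlope α X) p t +
        2 * α⁻¹ * κ p t ^ 2 * logSlope α X p t := by
  have hq := h.smoothOn_logSlope
  have hqs := h.smoothOn_spaceDeriv hq
  have hqq : SmoothOn U fun p t => logSlope α X p t ^ 2 := hq.pow 2
  have hκκ : SmoothOn U fun p t => κ p t ^ 2 := h.smoothOn_curvature.pow 2
  have hsum : SmoothOn U fun p t => ∂ₛ (logSlope α X) p t + logSlope α X p t ^ 2 := hqs.add hqq
  rw [spaceDeriv_add h.isOpen hsum hκκ hz, spaceDeriv_add h.isOpen hqs hqq hz,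
    spaceDeriv_sq h.isOpen hq hz, spaceDeriv_sq h.isOpen h.smoothOn_curvature hz,
    h.spaceDeriv_curvature hα hz]
  ring

theorem timeDeriv_logSlope (h : IsCurvedFlow α U X) (hα : α ≠ 0) (hz : (p, t) ∈ U) :
    ∂ₜ (logSlope α X) p t = diffusivity α X p t * (∂ₛ (∂ₛ (logSlope α X)) p t +
      (3 - α⁻¹) * logSlope α X p t * ∂ₛ (logSlope α X) p t +
      (1 - α⁻¹) * logSlope α X p t ^ 3 +
      (1 + 2 * α⁻¹) * κ p t ^ 2 * logSlope α X p t) := by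
  have hlog (p t : ℝ) (hz : (p, t) ∈ U) : ∂ₜ (fun p t => Real.log (speed α X p t)) p t =
      α * (speed α X p t ^ (1 - α⁻¹) *
        (∂ₛ (logSlope α X) p t + logSlope α X p t ^ 2 + κ p t ^ 2)) := by
    rw [h.timeDeriv_log_speed hα hz, diffusivity, mul_assoc]
  have hlower : speed α X p t * κ p t = α⁻¹ * diffusivity α X p t * κ p t ^ 2 := by
    have := h.diffusivity_mul_curvature hα hz
    field_simp
    linear_combination -κ p t * this
  calc ∂ₜ (logSlope α X) p t
      = ∂ₛ (∂ₜ fun p t => Real.log (speed α X p t)) p t +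
          speed α X p t * κ p t * logSlope α X p t :=
        h.timeDeriv_spaceDeriv h.smoothOn_log_speed hz
    _ = diffusivity α X p t * (∂ₛ (∂ₛ (logSlope α X)) p t +
          2 * logSlope α X p t * ∂ₛ (logSlope α X) p t +
          2 * α⁻¹ * κ p t ^ 2 * logSlope α X p t + (1 - α⁻¹) * logSlope α X p t *
            (∂ₛ (logSlope α X) p t + logSlope α X p t ^ 2 + κ p t ^ 2)) +
        speed α X p t * κ p t * logSlope α X p t := by
      rw [spaceDeriv_congr h.isOpen hlog hz, spaceDeriv_const_mul,
        spaceDeriv_rpow_mul _ h.isOpen h.smoothOn_speed (h.speed_pos hz)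
          h.smoothOn_spaceDeriv_logSlope_add_sq hz,
        h.spaceDeriv_spaceDeriv_logSlope_add_sq hα hz, diffusivity, logSlope]
      ring
    _ = _ := by
      rw [hlower]
      ring

theorem smoothOn_weightedSlope (h : IsCurvedFlow α U X) (β : ℝ) :
    SmoothOn U (weightedSlope α β X) :=
  (h.smoothOn_speed.rpow_const_of_ne fun _ hz => (h.speed_pos hz).ne').mul h.smoothOn_logSlope

theorem spaceDeriv_weightedSlope (h : IsCurvedFlow α U X) (β : ℝ) (hz : (p, t) ∈ U) :
    ∂ₛ (weightedSlope α β X) p t = speed α X p t ^ (1 - β) *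
      (∂ₛ (logSlope α X) p t + (1 - β) * logSlope α X p t ^ 2) := by
  refine (spaceDeriv_rpow_mul (1 - β) h.isOpen h.smoothOn_speed (h.speed_pos hz)
    h.smoothOn_logSlope hz).trans ?_
  rw [← logSlope]
  ring

theorem spaceDeriv_spaceDeriv_weightedSlope (h : IsCurvedFlow α U X) (β : ℝ)
    (hz : (p, t) ∈ U) :
    ∂ₛ (∂ₛ (weightedSlope α β X)) p t = speed α X p t ^ (1 - β) *
      (∂ₛ (∂ₛ (logSlope α X)) p t + 3 * (1 - β) * logSlope α X p t * ∂ₛ (logSlope α X) p t +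
        (1 - β) ^ 2 * logSlope α X p t ^ 3) := by
  have hq := h.smoothOn_logSlope
  have hqs := h.smoothOn_spaceDeriv hq
  have hqq : SmoothOn U fun p t => (1 - β) * logSlope α X p t ^ 2 :=
    contDiffOn_const.mul (hq.pow 2)
  have hsum : SmoothOn U fun p t =>
    ∂ₛ (logSlope α X) p t + (1 - β) * logSlope α X p t ^ 2 := hqs.add hqq
  rw [spaceDeriv_congr h.isOpen (fun _ _ hz => h.spaceDeriv_weightedSlope β hz) hz,
    spaceDeriv_rpow_mul _ h.isOpen h.smoothOn_speed (h.speed_pos hz) hsum hz,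
    spaceDeriv_add h.isOpen hqs hqq hz, spaceDeriv_const_mul, spaceDeriv_sq h.isOpen hq hz,
    ← logSlope]
  ring

theorem timeDeriv_weightedSlope (h : IsCurvedFlow α U X) (hα : α ≠ 0) (β : ℝ)
    (hz : (p, t) ∈ U) :
    ∂ₜ (weightedSlope α β X) p t = diffusivity α X p t * (∂ₛ (∂ₛ (weightedSlope α β X)) p t +
      (2 * β + 1 - α⁻¹) * logSlope α X p t * ∂ₛ (weightedSlope α β X) p t +
      ((2 + 2 * α⁻¹ - β) * κ p t ^ 2 - β * (α⁻¹ - β) * logSlope α X p t ^ 2) *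
        weightedSlope α β X p t) := by
  have hweight : ∂ₜ (weightedSlope α β X) p t = speed α X p t ^ (1 - β) *
      (∂ₜ (logSlope α X) p t + (1 - β) * ∂ₜ (fun p t => Real.log (speed α X p t)) p t *
        logSlope α X p t) :=
    timeDeriv_rpow_mul (1 - β) h.isOpen h.smoothOn_speed (h.speed_pos hz) h.smoothOn_logSlope hz
  rw [hweight, h.timeDeriv_logSlope hα hz, h.timeDeriv_log_speed hα hz,
    h.spaceDeriv_spaceDeriv_weightedSlope β hz, h.spaceDeriv_weightedSlope β hz, weightedSlope]
  ring

/-! ### The gradient estimate at a maximum point -/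

theorem smoothOn_cutoff (h : IsCurvedFlow α U X) (r : ℝ) : SmoothOn U (cutoff r X) :=
  contDiffOn_const.sub (h.smooth.norm_sq ℝ)

theorem spaceDeriv_cutoff (h : IsCurvedFlow α U X) (r : ℝ) (hz : (p, t) ∈ U) :
    ∂ₛ (cutoff r X) p t = -2 * ⟪X p t, 𝐓 p t⟫ := by
  have hX := (h.smooth.differentiableAt_param h.isOpen hz).hasDerivAt
  have hderiv : paramDeriv (cutoff r X) p t = -2 * ⟪X p t, paramDeriv X p t⟫ := by
    refine (hX.norm_sq.const_sub (r ^ 2)).deriv.trans ?_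
    rw [paramDeriv, neg_mul]
  rw [spaceDeriv_eq, spaceDeriv_eq, hderiv, real_inner_smul_right, smul_eq_mul,
    mul_left_comm]

theorem spaceDeriv_spaceDeriv_cutoff (h : IsCurvedFlow α U X) (r : ℝ) (hz : (p, t) ∈ U) :
    ∂ₛ (∂ₛ (cutoff r X)) p t = -2 * (1 + κ p t * ⟪X p t, 𝐍 p t⟫) := by
  rw [spaceDeriv_congr h.isOpen (fun _ _ hz => h.spaceDeriv_cutoff r hz) hz, spaceDeriv_const_mul,
    spaceDeriv_inner h.isOpen h.smooth h.smoothOn_tangent hz, real_inner_self_eq_norm_sq,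
    h.norm_tangent hz, h.spaceDeriv_tangent hz, real_inner_smul_right, one_pow]

theorem timeDeriv_cutoff (h : IsCurvedFlow α U X) (r : ℝ) (hz : (p, t) ∈ U) :
    ∂ₜ (cutoff r X) p t = -2 * (speed α X p t * ⟪X p t, 𝐍 p t⟫) := by
  have hX := (h.smooth.differentiableAt_time h.isOpen hz).hasDerivAt
  refine (hX.norm_sq.const_sub (r ^ 2)).deriv.trans ?_
  rw [← timeDeriv, h.flow p t hz, real_inner_smul_right, neg_mul]

theorem abs_inner_tangent_le (h : IsCurvedFlow α U X) (hz : (p, t) ∈ U) :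
    |⟪X p t, 𝐓 p t⟫| ≤ ‖X p t‖ := by
  simpa [h.norm_tangent hz] using abs_real_inner_le_norm (X p t) (𝐓 p t)

theorem abs_inner_normal_le (h : IsCurvedFlow α U X) (hz : (p, t) ∈ U) :
    |⟪X p t, 𝐍 p t⟫| ≤ ‖X p t‖ := by
  simpa [h.norm_normal hz] using abs_real_inner_le_norm (X p t) (𝐍 p t)

theorem smoothOn_localizedSlope (h : IsCurvedFlow α U X) (β r : ℝ) :
    SmoothOn U (localizedSlope α β r X) :=
  (h.smoothOn_cutoff r).mul (h.smoothOn_weightedSlope β)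

theorem spaceDeriv_localizedSlope (h : IsCurvedFlow α U X) (β r : ℝ) (hz : (p, t) ∈ U) :
    ∂ₛ (localizedSlope α β r X) p t = ∂ₛ (cutoff r X) p t * weightedSlope α β X p t +
      cutoff r X p t * ∂ₛ (weightedSlope α β X) p t :=
  spaceDeriv_mul h.isOpen (h.smoothOn_cutoff r) (h.smoothOn_weightedSlope β) hz

theorem spaceDeriv_spaceDeriv_localizedSlope (h : IsCurvedFlow α U X) (β r : ℝ)
    (hz : (p, t) ∈ U) :
    ∂ₛ (∂ₛ (localizedSlope α β r X)) p t =
      ∂ₛ (∂ₛ (cutoff r X)) p t * weightedSlope α β X p t +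
        2 * ∂ₛ (cutoff r X) p t * ∂ₛ (weightedSlope α β X) p t +
        cutoff r X p t * ∂ₛ (∂ₛ (weightedSlope α β X)) p t := by
  have he := h.smoothOn_cutoff r
  have hv := h.smoothOn_weightedSlope β
  have hes := h.smoothOn_spaceDeriv he
  have hvs := h.smoothOn_spaceDeriv hv
  have hev : SmoothOn U fun p t => ∂ₛ (cutoff r X) p t * weightedSlope α β X p t := hes.mul hv
  have hev' : SmoothOn U fun p t => cutoff r X p t * ∂ₛ (weightedSlope α β X) p t := he.mul hvs
  rw [spaceDeriv_congr h.isOpen (fun _ _ hz => h.spaceDeriv_localizedSlope β r hz) hz,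
    spaceDeriv_add h.isOpen hev hev' hz, spaceDeriv_mul h.isOpen hes hv hz,
    spaceDeriv_mul h.isOpen he hvs hz]
  ring

theorem timeDeriv_localizedSlope (h : IsCurvedFlow α U X) (β r : ℝ) (hz : (p, t) ∈ U) :
    ∂ₜ (localizedSlope α β r X) p t = ∂ₜ (cutoff r X) p t * weightedSlope α β X p t +
      cutoff r X p t * ∂ₜ (weightedSlope α β X) p t :=
  deriv_fun_mul ((h.smoothOn_cutoff r).differentiableAt_time h.isOpen hz)
    ((h.smoothOn_weightedSlope β).differentiableAt_time h.isOpen hz)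

theorem diffusivity_pos (h : IsCurvedFlow α U X) (hα : 0 < α) (hz : (p, t) ∈ U) :
    0 < diffusivity α X p t :=
  mul_pos hα (Real.rpow_pos_of_pos (h.speed_pos hz) _)

theorem inv_diffusivity (h : IsCurvedFlow α U X) (hα : α ≠ 0) (hz : (p, t) ∈ U) :
    (diffusivity α X p t)⁻¹ = κ p t / (α * speed α X p t) := by
  have hκ := (h.curvature_pos p t hz).ne'
  rw [← h.diffusivity_mul_curvature hα hz, div_mul_cancel_right₀ hκ]

theorem mul_sq_logSlope_add_le (h : IsCurvedFlow α U X) (hα : 0 < α) (hz : (p, t) ∈ U)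
    (hat : a < t) (hmax : IsParabolicMax a (localizedSlope α β r X) p t)
    (hne : localizedSlope α β r X p t ≠ 0) :
    β * (α⁻¹ - β) * (cutoff r X p t * logSlope α X p t) ^ 2 + (2 * β + 1 - α⁻¹) *
        ∂ₛ (cutoff r X) p t * (cutoff r X p t * logSlope α X p t) ≤
      2 * ∂ₛ (cutoff r X) p t ^ 2 - cutoff r X p t * ∂ₛ (∂ₛ (cutoff r X)) p t +
        (2 + 2 * α⁻¹ - β) * κ p t ^ 2 * cutoff r X p t ^ 2 +
        cutoff r X p t * ∂ₜ (cutoff r X) p t / diffusivity α X p t +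
        cutoff r X p t ^ 2 / (2 * (t - a) * diffusivity α X p t) := by
  have hspace := hmax.spaceDeriv_eq_zero (X := X) hat hne
  have hsecond := hmax.mul_spaceDeriv_spaceDeriv_nonpos hat h.toIsRegularFamily
    (h.smoothOn_localizedSlope β r) hz
  have htime := hmax.time_deriv_nonneg h.isOpen (h.smoothOn_localizedSlope β r) hz
  rw [h.spaceDeriv_localizedSlope β r hz] at hspace
  rw [h.spaceDeriv_spaceDeriv_localizedSlope β r hz] at hsecond
  rw [h.timeDeriv_localizedSlope β r hz] at htime
  exact mul_sq_add_le_of_max (h.diffusivity_pos hα hz) (sub_pos.2 hat)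
    (right_ne_zero_of_mul hne) hspace hsecond htime (h.timeDeriv_weightedSlope hα.ne' β hz)

theorem abs_spaceDeriv_cutoff_le (h : IsCurvedFlow α U X) (r : ℝ) (hz : (p, t) ∈ U)
    (hX : ‖X p t‖ ≤ 1) : |∂ₛ (cutoff r X) p t| ≤ 2 := by
  rw [h.spaceDeriv_cutoff r hz, abs_mul, abs_neg, abs_two]
  linarith [h.abs_inner_tangent_le hz]

theorem neg_spaceDeriv_spaceDeriv_cutoff_le (h : IsCurvedFlow α U X) (r : ℝ) (hz : (p, t) ∈ U)
    (hX : ‖X p t‖ ≤ 1) : -∂ₛ (∂ₛ (cutoff r X)) p t ≤ 2 * (1 + κ p t) := by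
  have hN := (abs_le.1 ((h.abs_inner_normal_le hz).trans hX)).2
  rw [h.spaceDeriv_spaceDeriv_cutoff r hz]
  linarith [mul_le_of_le_one_right (h.curvature_pos p t hz).le hN]

theorem timeDeriv_cutoff_div_diffusivity_le (h : IsCurvedFlow α U X) (hα : 0 < α) (r : ℝ)
    (hz : (p, t) ∈ U) (hX : ‖X p t‖ ≤ 1) :
    ∂ₜ (cutoff r X) p t / diffusivity α X p t ≤ 2 * α⁻¹ * κ p t := by
  have hu := h.speed_pos hz
  have hκ := h.curvature_pos p t hz
  have hN := (abs_le.1 ((h.abs_inner_normal_le hz).trans hX)).1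
  calc ∂ₜ (cutoff r X) p t / diffusivity α X p t
      = 2 * α⁻¹ * κ p t * -⟪X p t, 𝐍 p t⟫ := by
        rw [h.timeDeriv_cutoff r hz, div_eq_mul_inv, h.inv_diffusivity hα.ne' hz]
        field_simp
    _ ≤ 2 * α⁻¹ * κ p t := mul_le_of_le_one_right (by positivity) (by linarith)

theorem cutoff_sq_div_le (h : IsCurvedFlow α U X) (hα : 0 < α) (hz : (p, t) ∈ U)
    (he0 : 0 ≤ cutoff r X p t) (he1 : cutoff r X p t ≤ 1) (hat : a < t) :
    cutoff r X p t ^ 2 / (2 * (t - a) * diffusivity α X p t) ≤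
      κ p t / (2 * (t - a) * (α * speed α X p t)) := by
  have := sub_pos.2 hat
  have hD := h.diffusivity_pos hα hz
  have he2 : cutoff r X p t ^ 2 ≤ 1 := pow_le_one₀ he0 he1
  calc cutoff r X p t ^ 2 / (2 * (t - a) * diffusivity α X p t)
      ≤ 1 / (2 * (t - a) * diffusivity α X p t) := by gcongr
    _ = κ p t / (2 * (t - a) * (α * speed α X p t)) := by
      rw [one_div, mul_inv, h.inv_diffusivity hα.ne' hz, inv_mul_eq_div, div_div,
        mul_comm (α * _)]

theorem cutoff_terms_le (h : IsCurvedFlow α U X) (hα : 0 < α) (hβ : 0 ≤ β) (hr : r ≤ 1)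
    (hz : (p, t) ∈ U) (hXr : ‖X p t‖ ≤ r) (hat : a < t) :
    2 * ∂ₛ (cutoff r X) p t ^ 2 - cutoff r X p t * ∂ₛ (∂ₛ (cutoff r X)) p t +
        (2 + 2 * α⁻¹ - β) * κ p t ^ 2 * cutoff r X p t ^ 2 +
        cutoff r X p t * ∂ₜ (cutoff r X) p t / diffusivity α X p t +
        cutoff r X p t ^ 2 / (2 * (t - a) * diffusivity α X p t) ≤
      10 + (2 + 2 * α⁻¹) * (κ p t + κ p t ^ 2) +
        κ p t / (2 * (t - a) * (α * speed α X p t)) := by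
  have hκ := h.curvature_pos p t hz
  have he0 := cutoff_nonneg hXr
  have he1 := cutoff_le_one hr hXr
  have hfirst : ∂ₛ (cutoff r X) p t ^ 2 ≤ 2 ^ 2 :=
    sq_le_sq.2 ((h.abs_spaceDeriv_cutoff_le r hz (hXr.trans hr)).trans_eq abs_two.symm)
  have hsecond : cutoff r X p t * -∂ₛ (∂ₛ (cutoff r X)) p t ≤ 2 * (1 + κ p t) :=
    (mul_le_mul_of_nonneg_left (h.neg_spaceDeriv_spaceDeriv_cutoff_le r hz (hXr.trans hr))
      he0).trans (mul_le_of_le_one_left (by positivity) he1)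
  have hreaction : (2 + 2 * α⁻¹ - β) * (κ p t ^ 2 * cutoff r X p t ^ 2) ≤
      (2 + 2 * α⁻¹) * (κ p t ^ 2 * 1) := by
    gcongr
    · linarith
    · exact pow_le_one₀ he0 he1
  have htime : cutoff r X p t * (∂ₜ (cutoff r X) p t / diffusivity α X p t) ≤
      2 * α⁻¹ * κ p t :=
    (mul_le_mul_of_nonneg_left (h.timeDeriv_cutoff_div_diffusivity_le hα r hz (hXr.trans hr))
      he0).trans (mul_le_of_le_one_left (by positivity) he1)
  have hinitial := h.cutoff_sq_div_le hα hz he0 he1 hat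
  rw [mul_div_assoc]
  linarith

theorem mul_sq_abs_logSlope_le (h : IsCurvedFlow α U X) (hα : 0 < α) (hβ : 0 ≤ β) (hr : r ≤ 1)
    (hz : (p, t) ∈ U) (hXr : ‖X p t‖ ≤ r) (hat : a < t)
    (hmax : IsParabolicMax a (localizedSlope α β r X) p t)
    (hne : localizedSlope α β r X p t ≠ 0) :
    β * (α⁻¹ - β) * |cutoff r X p t * logSlope α X p t| ^ 2 ≤
      2 * |2 * β + 1 - α⁻¹| * |cutoff r X p t * logSlope α X p t| +
        (10 + (2 + 2 * α⁻¹) * (κ p t + κ p t ^ 2) +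
          κ p t / (2 * (t - a) * (α * speed α X p t))) := by
  have hspace := h.abs_spaceDeriv_cutoff_le r hz (hXr.trans hr)
  have hdrift : -((2 * β + 1 - α⁻¹) * ∂ₛ (cutoff r X) p t *
      (cutoff r X p t * logSlope α X p t)) ≤
      2 * |2 * β + 1 - α⁻¹| * |cutoff r X p t * logSlope α X p t| := by
    refine (neg_le_abs _).trans ?_
    rw [abs_mul, abs_mul, mul_comm 2 |_|]
    gcongr
  rw [sq_abs]
  linarith [h.mul_sq_logSlope_add_le hα hz hat hmax hne, h.cutoff_terms_le hα hβ hr hz hXr hat]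

theorem curvature_div_speed_mul_rpow_sq (h : IsCurvedFlow α U X) (hα : α ≠ 0) (β : ℝ)
    (hz : (p, t) ∈ U) : κ p t / speed α X p t * (speed α X p t ^ (1 - β)) ^ 2 =
      speed α X p t ^ (α⁻¹ + 1 - 2 * β) := by
  have hu := h.speed_pos hz
  rw [← h.speed_rpow_inv hα hz, ← Real.rpow_sub_one hu.ne', ← Real.rpow_mul_natCast hu.le,
    ← Real.rpow_add hu]
  congr 1
  push_cast
  ring

end IsCurvedFlow

/-- The constant in the bound for `(t - a) (r² - |X|²)² (u^{-β} ∂_s u)²`, where `L` bounds `u`, so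
that `L ^ α⁻¹` bounds the curvature. -/
noncomputable def gradientConstant (α β L : ℝ) : ℝ :=
  (((2 * |2 * β + 1 - α⁻¹|) ^ 2 / (β * (α⁻¹ - β)) +
      2 * (10 + (2 + 2 * α⁻¹) * (L ^ α⁻¹ + (L ^ α⁻¹) ^ 2))) * (L ^ (1 - β)) ^ 2 +
    α⁻¹ * L ^ (α⁻¹ + 1 - 2 * β)) / (β * (α⁻¹ - β))

theorem gradientConstant_nonneg {α β L : ℝ} (hα : 0 ≤ α) (hβ : 0 ≤ β) (hβα : β ≤ α⁻¹)
    (hL : 0 ≤ L) : 0 ≤ gradientConstant α β L := by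
  have := sub_nonneg.2 hβα
  rw [gradientConstant]
  positivity

theorem IsCurvedFlow.sub_mul_sq_localizedSlope_le {α β L a r p t : ℝ} {U : Set (ℝ × ℝ)}
    {X : ℝ → ℝ → Plane} (h : IsCurvedFlow α U X) (hα : 0 < α) (hβ : 0 < β) (hβ1 : β ≤ 1)
    (hβα : β < α⁻¹) (hr : r ≤ 1) (hz : (p, t) ∈ U) (hXr : ‖X p t‖ ≤ r)
    (hL : speed α X p t ≤ L) (hat : a < t)
    (hmax : IsParabolicMax a (localizedSlope α β r X) p t) :
    (t - a) * localizedSlope α β r X p t ^ 2 ≤ gradientConstant α β L * (1 + (t - a)) := by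
  have hu := h.speed_pos hz
  have hκ := h.curvature_pos p t hz
  have hc : 0 < β * (α⁻¹ - β) := mul_pos hβ (sub_pos.2 hβα)
  have hL0 := hu.trans_le hL
  obtain hG | hG := eq_or_ne (localizedSlope α β r X p t) 0
  · rw [hG, zero_pow two_ne_zero, mul_zero]
    exact mul_nonneg (gradientConstant_nonneg hα.le hβ.le hβα.le hL0.le) (by linarith)
  have hκL : familyCurvature X p t ≤ L ^ α⁻¹ := by
    rw [← h.speed_rpow_inv hα.ne' hz]
    gcongr
  have hwL : speed α X p t ^ (1 - β) ≤ L ^ (1 - β) :=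
    Real.rpow_le_rpow hu.le hL (sub_nonneg.2 hβ1)
  have hpowL : familyCurvature X p t / speed α X p t * (speed α X p t ^ (1 - β)) ^ 2 ≤
      L ^ (α⁻¹ + 1 - 2 * β) :=
    (h.curvature_div_speed_mul_rpow_sq hα.ne' β hz).trans_le
      (Real.rpow_le_rpow hu.le hL (by linarith))
  have hQ := mul_sq_le_of_mul_sq_le_add hc
    (h.mul_sq_abs_logSlope_le hα hβ.le hr hz hXr hat hmax hG)
  rw [sq_abs, mul_add 2, ← add_assoc] at hQ
  rw [gradientConstant, div_mul_eq_mul_div, le_div_iff₀' hc]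
  refine mul_mul_sq_le_of_mul_sq_le hα (sub_pos.2 hat) hu.ne' (by positivity) hwL ?_ ?_
    (by positivity) hpowL hQ
  · gcongr
  · positivity

/-! ### Properness of convex complete curves -/

theorem image_mem_nhds_of_injOn {f : ℝ → ℝ} {s : Set ℝ} {x : ℝ} (hs : s ∈ 𝓝 x)
    (hf : ContinuousOn f s) (hinj : InjOn f s) : f '' s ∈ 𝓝 (f x) := by
  obtain ⟨a, b, hx, hab, habs⟩ := exists_Icc_mem_subset_of_mem_nhds hs
  obtain ⟨hax, hxb⟩ : a < x ∧ x < b := Icc_mem_nhds_iff.1 hab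
  have hle : a ≤ b := (hax.trans hxb).le
  have ha : a ∈ Icc a b := left_mem_Icc.2 hle
  have hb : b ∈ Icc a b := right_mem_Icc.2 hle
  refine mem_of_superset ?_ (image_mono habs)
  obtain hmono | hanti :=
    (hf.mono habs).strictMonoOn_of_injOn_Icc' hle (hinj.mono habs)
  · exact mem_of_superset (Icc_mem_nhds (hmono ha hx hax) (hmono hx hb hxb))
      (intermediate_value_Icc hle (hf.mono habs))
  · exact mem_of_superset (Icc_mem_nhds (hanti hx hb hxb) (hanti ha hx hax))
      (intermediate_value_Icc' hle (hf.mono habs))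

theorem isEmbedding_of_injOn_coordinate {Y : Type*} [TopologicalSpace Y] {γ : ℝ → Y}
    (hγ : Continuous γ) (hinj : Function.Injective γ)
    (h : ∀ q, ∃ V, IsOpen V ∧ γ q ∈ V ∧
      ∃ φ : Y → ℝ, ContinuousOn φ V ∧ InjOn φ (range γ ∩ V)) : IsEmbedding γ := by
  refine ⟨isInducing_iff_nhds.2 fun q => (hγ.tendsto q).le_comap.antisymm fun N hN => ?_, hinj⟩
  obtain ⟨V, hVo, hqV, φ, hφ, hφinj⟩ := h q
  have hV := hVo.mem_nhds hqV
  set s : Set ℝ := N ∩ γ ⁻¹' V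
  have hs : s ∈ 𝓝 q := inter_mem hN (hγ.continuousAt hV)
  have hφγ : InjOn (φ ∘ γ) (γ ⁻¹' V) := fun p hp p' hp' heq =>
    hinj (hφinj ⟨mem_range_self p, hp⟩ ⟨mem_range_self p', hp'⟩ heq)
  have himage : φ ∘ γ '' s ∈ 𝓝 (φ (γ q)) :=
    image_mem_nhds_of_injOn hs (hφ.comp hγ.continuousOn inter_subset_right)
      (hφγ.mono inter_subset_right)
  refine mem_comap.2 ⟨V ∩ φ ⁻¹' (φ ∘ γ '' s),
    inter_mem hV ((hφ.continuousAt hV).preimage_mem_nhds himage), ?_⟩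
  rintro p ⟨hp, p', hp', heq⟩
  exact hφγ hp'.2 hp heq ▸ hp'.1

theorem one_le_of_mem_frontier_of_smul_sub_eq {E : Type*} [AddCommGroup E] [Module ℝ E]
    [TopologicalSpace E] [IsTopologicalAddGroup E] [ContinuousConstSMul ℝ E] {K : Set E}
    (hK : Convex ℝ K) {o y z : E} (ho : o ∈ interior K) (hy : y ∈ frontier K)
    (hz : z ∈ frontier K) {c : ℝ} (hc : 0 < c) (h : c • (y - o) = z - o) : 1 ≤ c := by
  by_contra! hc1
  have hmem := hK.combo_interior_closure_mem_interior ho hy.1 (sub_pos.2 hc1) hc.le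
    (sub_add_cancel 1 c)
  have heq : z = (1 - c) • o + c • y := by
    rw [← sub_add_cancel z o, ← h]
    module
  exact hz.2 (heq ▸ hmem)

theorem eq_of_mem_frontier_of_sameRay {E : Type*} [AddCommGroup E] [Module ℝ E]
    [TopologicalSpace E] [IsTopologicalAddGroup E] [ContinuousConstSMul ℝ E] {K : Set E}
    (hK : Convex ℝ K) {o y z : E} (ho : o ∈ interior K) (hy : y ∈ frontier K)
    (hz : z ∈ frontier K) (h : SameRay ℝ (y - o) (z - o)) : y = z := by
  have hne : ∀ {x}, x ∈ frontier K → x - o ≠ 0 := fun hx h0 => hx.2 (sub_eq_zero.1 h0 ▸ ho)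
  obtain ⟨c, hc, hcz⟩ := h.exists_pos_left (hne hy) (hne hz)
  have hcy : c⁻¹ • (z - o) = y - o := by rw [← hcz, inv_smul_smul₀ hc.ne']
  have hc1 : c = 1 := le_antisymm
    ((one_le_inv₀ hc).1 (one_le_of_mem_frontier_of_smul_sub_eq hK ho hz hy (inv_pos.2 hc) hcy))
    (one_le_of_mem_frontier_of_smul_sub_eq hK ho hy hz hc hcz)
  rwa [hc1, one_smul, sub_left_inj] at hcz

theorem sameRay_of_areaForm_div_inner_eq {E : Type*} [NormedAddCommGroup E]
    [InnerProductSpace ℝ E] [Fact (Module.finrank ℝ E = 2)] (ori : Orientation ℝ E (Fin 2))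
    {a x y : E} (hx : 0 < ⟪a, x⟫) (hy : 0 < ⟪a, y⟫)
    (h : ori.areaForm a x / ⟪a, x⟫ = ori.areaForm a y / ⟪a, y⟫) : SameRay ℝ x y := by
  have ha : 0 < ‖a‖ ^ 2 := by
    have : a ≠ 0 := fun h0 => hx.ne' (by rw [h0, inner_zero_left])
    positivity
  rw [div_eq_div_iff hx.ne' hy.ne'] at h
  refine (ori.nonneg_inner_and_areaForm_eq_zero_iff_sameRay x y).1 ⟨?_, ?_⟩
  · have harea : ori.areaForm a x * ori.areaForm a y * ⟪a, x⟫ ^ 2 =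
        ori.areaForm a x ^ 2 * (⟪a, x⟫ * ⟪a, y⟫) := by
      linear_combination -(ori.areaForm a x * ⟪a, x⟫) * h
    have hnonneg : 0 ≤ ori.areaForm a x * ori.areaForm a y :=
      nonneg_of_mul_nonneg_left (harea.ge.trans' (by positivity)) (pow_pos hx 2)
    have hinner := ori.inner_mul_inner_add_areaForm_mul_areaForm a x y
    exact nonneg_of_mul_nonneg_right (hinner.le.trans' (add_nonneg (mul_pos hx hy).le hnonneg)) ha
  · have harea := ori.inner_mul_areaForm_sub a x y
    exact (mul_eq_zero.1 (harea.symm.trans (by linear_combination -h))).resolve_left ha.ne'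

/-- Near each of its points, the central projection from an interior point of `K`, read off as a
slope, is an injective coordinate of the curve. -/
theorem ParametrizesBoundary.isClosedEmbedding {γ : ℝ → Plane} {K : Set Plane}
    (h : ParametrizesBoundary γ K) (hK : Convex ℝ K) : IsClosedEmbedding γ := by
  refine ⟨isEmbedding_of_injOn_coordinate h.smooth.continuous h.injective fun q => ?_,
    h.frontier_eq ▸ isClosed_frontier⟩
  have : Fact (Module.finrank ℝ Plane = 2) := ⟨finrank_euclideanSpace_fin⟩
  let ori : Orientation ℝ Plane (Fin 2) := (EuclideanSpace.basisFun (Fin 2) ℝ).toBasis.orientation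
  obtain ⟨o, ho⟩ := h.interior_nonempty
  set a : Plane := γ q - o
  have hq : γ q ∈ frontier K := h.frontier_eq ▸ mem_range_self q
  have ha0 : a ≠ 0 := fun h0 => hq.2 (sub_eq_zero.1 h0 ▸ ho)
  have hinner : Continuous fun y : Plane => ⟪a, y - o⟫ := by fun_prop
  have harea : Continuous fun y : Plane => ori.areaForm a (y - o) :=
    (ori.areaForm a).continuous_of_finiteDimensional.comp (continuous_sub_right o)
  have hopen : IsOpen {y | 0 < ⟪a, y - o⟫} := isOpen_lt continuous_const hinner
  refine ⟨{y | 0 < ⟪a, y - o⟫}, hopen, real_inner_self_pos.2 ha0,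
    fun y => ori.areaForm a (y - o) / ⟪a, y - o⟫,
    harea.continuousOn.div hinner.continuousOn fun y hy => ne_of_gt hy, ?_⟩
  rw [← h.frontier_eq]
  exact fun y hy z hz heq => eq_of_mem_frontier_of_sameRay hK ho hy.1 hz.1
    (sameRay_of_areaForm_div_inner_eq ori hy.2 hz.2 heq)

theorem IsConvexCompleteCurve.isCompact_preimage_closedBall {γ : ℝ → Plane}
    (h : IsConvexCompleteCurve γ) (x : Plane) (R : ℝ) :
    IsCompact (γ ⁻¹' Metric.closedBall x R) := by
  obtain ⟨K, hK, hγ⟩ := h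
  exact (hγ.isClosedEmbedding hK).isCompact_preimage (isCompact_closedBall x R)

/-! ### Compactness in space-time and the conclusion -/

theorem speed_nonneg (α : ℝ) (X : ℝ → ℝ → Plane) (p t : ℝ) : 0 ≤ speed α X p t :=
  Real.rpow_nonneg (norm_nonneg _) _

namespace IsConvexCompleteSolution

variable {α L : ℝ} {X : ℝ → ℝ → Plane}

theorem norm_le_of_speed_le (hX : IsConvexCompleteSolution α X) (hL0 : 0 ≤ L)
    (hL : ∀ p t, 0 < t → X p t ∈ Metric.ball (0 : Plane) 1 → speed α X p t ≤ L)
    {p t s r : ℝ} (ht : 0 < t) (hts : t ≤ s) (hr : ‖X p t‖ ≤ r)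
    (hs : r + (L + 1) * (s - t) < 1) : ‖X p s‖ ≤ r + (L + 1) * (s - t) := by
  have hvelocity : ∀ x, 0 < x → ∃ v : Plane, ‖v‖ = speed α X p x ∧ HasDerivAt (X p) v x := by
    intro x hx
    obtain ⟨n, hn, hv⟩ := hX.flow p x hx
    refine ⟨_, ?_, hv⟩
    rw [norm_smul, hn.norm_eq_one, mul_one, Real.norm_of_nonneg (speed_nonneg α X p x)]
  choose! v hv hXv using hvelocity
  have hB : ∀ x, HasDerivAt (fun x => r + (L + 1) * (x - t)) (L + 1) x := fun x => by
    simpa using (((hasDerivAt_id x).sub_const t).const_mul (L + 1)).const_add r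
  refine image_norm_le_of_norm_deriv_right_lt_deriv_boundary
    (fun x hx => (hXv x (ht.trans_le hx.1)).continuousAt.continuousWithinAt)
    (fun x hx => (hXv x (ht.trans_le hx.1)).hasDerivWithinAt) (by simpa using hr) hB
    (fun x hx heq => ?_) ⟨hts, le_rfl⟩
  have hx0 : 0 < x := ht.trans_le hx.1
  have hx1 : ‖X p x‖ < 1 := by
    have := hx.2
    calc ‖X p x‖ = r + (L + 1) * (x - t) := heq
      _ ≤ r + (L + 1) * (s - t) := by gcongr
      _ < 1 := hs
  rw [hv x hx0]
  linarith [hL p x hx0 (mem_ball_zero_iff.2 hx1)]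

theorem isClosed_region (hX : IsConvexCompleteSolution α X) {a : ℝ} (ha : 0 ≤ a) (b r : ℝ) :
    IsClosed {z : ℝ × ℝ | z.2 ∈ Icc a b ∧ ‖X z.1 z.2‖ ≤ r} := by
  have hcont : ContinuousOn (fun z : ℝ × ℝ => ‖X z.1 z.2‖) (univ ×ˢ Icc a b) :=
    (hX.continuous.mono (prod_mono le_rfl fun t ht => ha.trans ht.1)).norm
  have heq : {z : ℝ × ℝ | z.2 ∈ Icc a b ∧ ‖X z.1 z.2‖ ≤ r} =
      univ ×ˢ Icc a b ∩ (fun z => ‖X z.1 z.2‖) ⁻¹' Iic r := by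
    ext z
    simp
  exact heq ▸ hcont.preimage_isClosed_of_isClosed (isClosed_univ.prod isClosed_Icc) isClosed_Iic

theorem isBounded_setOf_norm_le (hX : IsConvexCompleteSolution α X) {t : ℝ} (ht : 0 ≤ t)
    (r : ℝ) : Bornology.IsBounded {p | ‖X p t‖ ≤ r} := by
  have heq : {p | ‖X p t‖ ≤ r} = (fun p => X p t) ⁻¹' Metric.closedBall 0 r := by
    ext p
    simp
  exact heq ▸ ((hX.convex_complete t ht).isCompact_preimage_closedBall 0 r).isBounded

/-- Shortly after a time at which it is in the smaller ball, a point is still in the unit ball, so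
finitely many time slices control all of `[a, b]`. -/
theorem isBounded_iUnion_setOf_norm_le (hX : IsConvexCompleteSolution α X) (hL0 : 0 ≤ L)
    (hL : ∀ p t, 0 < t → X p t ∈ Metric.ball (0 : Plane) 1 → speed α X p t ≤ L)
    {a r : ℝ} (ha : 0 < a) (b : ℝ) (hr : r < 1) :
    Bornology.IsBounded (⋃ t ∈ Icc a b, {p | ‖X p t‖ ≤ r}) := by
  set δ := (1 - r) / (3 * (L + 1)) with hδ
  have hδ0 : 0 < δ := div_pos (sub_pos.2 hr) (by positivity)
  have hLδ : r + (L + 1) * (2 * δ) < 1 := by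
    have : (L + 1) * (2 * δ) = 2 * (1 - r) / 3 := by
      rw [hδ]
      field_simp
    linarith
  obtain ⟨T, hT, hcover⟩ := (isCompact_Icc (a := a) (b := b)).elim_nhds_subcover
    (fun τ => Ioo (τ - δ) (τ + δ)) fun τ _ => Ioo_mem_nhds (by linarith) (by linarith)
  have hbounded : Bornology.IsBounded (⋃ τ ∈ T, {p | ‖X p (τ + δ)‖ ≤ 1}) :=
    (Bornology.isBounded_biUnion_finset T).2 fun τ hτ =>
      hX.isBounded_setOf_norm_le (by linarith [(hT τ hτ).1]) 1
  refine hbounded.subset (iUnion₂_subset fun t ht p hp => ?_)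
  obtain ⟨τ, hτ, hτt⟩ := mem_iUnion₂.1 (hcover ht)
  refine mem_iUnion₂.2 ⟨τ, hτ, ?_⟩
  have hstep : (L + 1) * (τ + δ - t) ≤ (L + 1) * (2 * δ) := by
    have := hτt.1
    gcongr
    linarith
  exact (hX.norm_le_of_speed_le hL0 hL (ha.trans_le ht.1) hτt.2.le hp
    (by linarith)).trans (by linarith)

theorem isCompact_region (hX : IsConvexCompleteSolution α X) (hL0 : 0 ≤ L)
    (hL : ∀ p t, 0 < t → X p t ∈ Metric.ball (0 : Plane) 1 → speed α X p t ≤ L)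
    {a r : ℝ} (ha : 0 < a) (b : ℝ) (hr : r < 1) :
    IsCompact {z : ℝ × ℝ | z.2 ∈ Icc a b ∧ ‖X z.1 z.2‖ ≤ r} := by
  refine Metric.isCompact_of_isClosed_isBounded (hX.isClosed_region ha.le b r) ?_
  refine ((hX.isBounded_iUnion_setOf_norm_le hL0 hL ha b hr).prod
    (Metric.isBounded_Icc a b)).subset ?_
  exact fun z hz => ⟨mem_iUnion₂.2 ⟨z.2, hz.1, hz.2⟩, hz.1⟩

end IsConvexCompleteSolution

/-- The points of space-time, at positive times, at which the family `X` is in the unit ball. -/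
def unitBallRegion (X : ℝ → ℝ → Plane) : Set (ℝ × ℝ) :=
  univ ×ˢ Ioi 0 ∩ Function.uncurry X ⁻¹' Metric.ball 0 1

theorem isParabolicMax_of_isMaxOn_region {X : ℝ → ℝ → Plane} {f : ℝ → ℝ → ℝ} {a b r p t : ℝ}
    (hX : ContinuousAt (Function.uncurry X) (p, t)) (hat : a < t) (htb : t ≤ b)
    (hr : ‖X p t‖ < r)
    (hmax : IsMaxOn (fun z : ℝ × ℝ => (z.2 - a) * f z.1 z.2 ^ 2)
      {z | z.2 ∈ Icc a b ∧ ‖X z.1 z.2‖ ≤ r} (p, t)) :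
    IsParabolicMax a f p t := by
  have hnear : ∀ᶠ z in 𝓝 (p, t), ‖X z.1 z.2‖ < r :=
    hX.norm.eventually_lt continuousAt_const hr
  have hafter : ∀ᶠ z : ℝ × ℝ in 𝓝 (p, t), a < z.2 :=
    continuousAt_snd.eventually_const_lt hat
  filter_upwards [nhdsWithin_le_nhds hnear, nhdsWithin_le_nhds hafter, self_mem_nhdsWithin]
    with z hzr haz hzt
  exact hmax ⟨⟨haz.le, hzt.trans htb⟩, hzr.le⟩

namespace IsConvexCompleteSolution

variable {α β L : ℝ} {X : ℝ → ℝ → Plane}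

theorem isOpen_unitBallRegion (hX : IsConvexCompleteSolution α X) : IsOpen (unitBallRegion X) :=
  hX.smooth.continuousOn.isOpen_inter_preimage (isOpen_univ.prod isOpen_Ioi) Metric.isOpen_ball

theorem continuousAt (hX : IsConvexCompleteSolution α X) {p t : ℝ} (ht : 0 < t) :
    ContinuousAt (Function.uncurry X) (p, t) :=
  hX.smooth.continuousOn.continuousAt
    ((isOpen_univ.prod isOpen_Ioi).mem_nhds ⟨mem_univ p, ht⟩)

theorem isCurvedFlow (hX : IsConvexCompleteSolution α X) (hα : α ≠ 0)
    (hpos : ∀ p t, 0 < t → X p t ∈ Metric.ball (0 : Plane) 1 → 0 < speed α X p t) :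
    IsCurvedFlow α (unitBallRegion X) X := by
  have hcurvature : ∀ p t, (p, t) ∈ unitBallRegion X → 0 < familyCurvature X p t := by
    refine fun p t hz => (norm_nonneg _).lt_of_ne' fun h0 => (hpos p t hz.1.2 hz.2).ne' ?_
    exact (congrArg (· ^ α) h0).trans (Real.zero_rpow hα)
  refine ⟨⟨hX.isOpen_unitBallRegion, hX.smooth.mono inter_subset_left, fun p t hz => ?_⟩,
    hcurvature, fun p t hz => ?_⟩
  · obtain ⟨K, -, hγ⟩ := hX.convex_complete t (le_of_lt hz.1.2)
    exact hγ.regular p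
  · obtain ⟨K, -, hγ⟩ := hX.convex_complete t (le_of_lt hz.1.2)
    obtain ⟨n, hn, hflow⟩ := hX.flow p t hz.1.2
    have hFrenet : spaceDeriv X (spaceDeriv X X) p t = familyCurvature X p t • n :=
      hn.arcDeriv_arcDeriv_self (hγ.smooth.of_le (WithTop.coe_le_coe.2 le_top)) hγ.regular
    rw [principalNormal, hFrenet, inv_smul_smul₀ (hcurvature p t hz).ne']
    exact hflow.deriv

theorem sub_mul_sq_localizedSlope_le_of_isMaxOn (hX : IsConvexCompleteSolution α X)
    (hα : 0 < α) (hβ : 0 < β) (hβ1 : β ≤ 1) (hβα : β < α⁻¹)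
    (hu : ∀ p t, 0 < t → X p t ∈ Metric.ball (0 : Plane) 1 →
      0 < speed α X p t ∧ speed α X p t ≤ L)
    {a b r p t : ℝ} (ha : 0 < a) (hr : r < 1) (hat : a ≤ t) (htb : t ≤ b) (hp : ‖X p t‖ ≤ r)
    (hmax : IsMaxOn (fun z : ℝ × ℝ => (z.2 - a) * localizedSlope α β r X z.1 z.2 ^ 2)
      {z | z.2 ∈ Icc a b ∧ ‖X z.1 z.2‖ ≤ r} (p, t)) :
    (t - a) * localizedSlope α β r X p t ^ 2 ≤ gradientConstant α β L * (1 + (t - a)) := by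
  have ht : 0 < t := ha.trans_le hat
  have hball : X p t ∈ Metric.ball (0 : Plane) 1 := mem_ball_zero_iff.2 (hp.trans_lt hr)
  obtain ⟨hu0, huL⟩ := hu p t ht hball
  have hbound : 0 ≤ gradientConstant α β L * (1 + (t - a)) :=
    mul_nonneg (gradientConstant_nonneg hα.le hβ.le hβα.le (hu0.le.trans huL)) (by linarith)
  obtain hat' | hat' := hat.eq_or_lt
  · refine (Eq.le ?_).trans hbound
    rw [hat', sub_self, zero_mul]
  obtain hpr | hpr := hp.eq_or_lt
  · refine (Eq.le ?_).trans hbound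
    rw [localizedSlope, cutoff, hpr, sub_self, zero_mul, zero_pow two_ne_zero, mul_zero]
  exact (hX.isCurvedFlow hα.ne' fun p t ht hb => (hu p t ht hb).1).sub_mul_sq_localizedSlope_le
    hα hβ hβ1 hβα hr.le ⟨⟨mem_univ p, ht⟩, hball⟩ hp huL hat'
    (isParabolicMax_of_isMaxOn_region (hX.continuousAt ht) hat' htb hpr hmax)

theorem sub_mul_sq_localizedSlope_le (hX : IsConvexCompleteSolution α X) (hα : 0 < α)
    (hβ : 0 < β) (hβ1 : β ≤ 1) (hβα : β < α⁻¹)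
    (hu : ∀ p t, 0 < t → X p t ∈ Metric.ball (0 : Plane) 1 →
      0 < speed α X p t ∧ speed α X p t ≤ L)
    {a b r p : ℝ} (ha : 0 < a) (hab : a ≤ b) (hr : r < 1) (hp : ‖X p b‖ ≤ r) :
    (b - a) * localizedSlope α β r X p b ^ 2 ≤ gradientConstant α β L * (1 + (b - a)) := by
  have hflow := hX.isCurvedFlow hα.ne' fun p t ht hb => (hu p t ht hb).1
  have hball : ∀ {q t}, ‖X q t‖ ≤ r → X q t ∈ Metric.ball (0 : Plane) 1 := fun hq =>
    mem_ball_zero_iff.2 (hq.trans_lt hr)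
  have hL0 : 0 ≤ L := (speed_nonneg α X p b).trans (hu p b (ha.trans_le hab) (hball hp)).2
  have hC : 0 ≤ gradientConstant α β L := gradientConstant_nonneg hα.le hβ.le hβα.le hL0
  set D : Set (ℝ × ℝ) := {z | z.2 ∈ Icc a b ∧ ‖X z.1 z.2‖ ≤ r}
  have hD : IsCompact D := hX.isCompact_region hL0 (fun p t ht hb => (hu p t ht hb).2) ha b hr
  have hDU : D ⊆ unitBallRegion X := fun z hz =>
    ⟨⟨mem_univ _, ha.trans_le hz.1.1⟩, hball hz.2⟩
  have hcont : ContinuousOn (fun z : ℝ × ℝ => (z.2 - a) * localizedSlope α β r X z.1 z.2 ^ 2) D :=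
    (continuousOn_snd.sub continuousOn_const).mul
      (((hflow.smoothOn_localizedSlope β r).continuousOn.mono hDU).pow 2)
  have hpD : (p, b) ∈ D := ⟨right_mem_Icc.2 hab, hp⟩
  obtain ⟨⟨q, t⟩, ⟨⟨hat, htb⟩, hq⟩, hmax⟩ := hD.exists_isMaxOn ⟨_, hpD⟩ hcont
  dsimp only at hat htb hq
  calc (b - a) * localizedSlope α β r X p b ^ 2
      ≤ (t - a) * localizedSlope α β r X q t ^ 2 := hmax hpD
    _ ≤ gradientConstant α β L * (1 + (t - a)) :=
      hX.sub_mul_sq_localizedSlope_le_of_isMaxOn hα hβ hβ1 hβα hu ha hr hat htb hq hmax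
    _ ≤ gradientConstant α β L * (1 + (b - a)) := by gcongr

end IsConvexCompleteSolution

theorem abs_le_of_mul_sq_le {C T e y : ℝ} (hT : 0 < T) (he : 5 / 16 ≤ e)
    (h : T / 2 * (e * y) ^ 2 ≤ C * (1 + T / 2)) :
    |y| ≤ √(21 * C) * (1 + T ^ (-(1 / 2 : ℝ))) := by
  have hC : 0 ≤ C := nonneg_of_mul_nonneg_left (h.trans' (by positivity)) (by positivity)
  have hT' : (T ^ (-(1 / 2 : ℝ))) ^ 2 = T⁻¹ := by
    rw [← Real.rpow_mul_natCast hT.le]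
    norm_num [Real.rpow_neg_one]
  have hs : 0 < T ^ (-(1 / 2 : ℝ)) := Real.rpow_pos_of_pos hT _
  refine abs_le_of_sq_le_sq ?_ (by positivity)
  have hy : T / 2 * ((5 / 16) ^ 2 * y ^ 2) ≤ T / 2 * (C * (1 + 2 * T⁻¹)) :=
    calc T / 2 * ((5 / 16) ^ 2 * y ^ 2)
        ≤ T / 2 * (e ^ 2 * y ^ 2) := by gcongr
      _ ≤ C * (1 + T / 2) := by rwa [← mul_pow]
      _ = T / 2 * (C * (1 + 2 * T⁻¹)) := by
        field_simp
        ring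
  have hsum : C * (1 + T⁻¹) ≤ C * (1 + T ^ (-(1 / 2 : ℝ))) ^ 2 := by
    rw [← hT']
    gcongr
    linarith
  have hCT : 0 ≤ C * T⁻¹ := by positivity
  rw [mul_pow, Real.sq_sqrt (by positivity)]
  linarith [le_of_mul_le_mul_left hy (half_pos hT)]

theorem IsCurvedFlow.spaceDeriv_speed_eq_weightedSlope_mul {α : ℝ} {U : Set (ℝ × ℝ)}
    {X : ℝ → ℝ → Plane} {p t : ℝ} (h : IsCurvedFlow α U X) (β : ℝ) (hz : (p, t) ∈ U) :
    spaceDeriv X (speed α X) p t = weightedSlope α β X p t * speed α X p t ^ β := by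
  rw [h.spaceDeriv_speed hz, weightedSlope, mul_right_comm, ← Real.rpow_add (h.speed_pos hz),
    sub_add_cancel, Real.rpow_one]

end AlphaCSF

theorem proposition3p1_general {α β : ℝ} (hα : 0 < α) (hβ : 0 < β) (hβ1 : β ≤ 1)
    (hβα : β < α⁻¹) (L : ℝ) :
    ∃ C : ℝ, ∀ X : ℝ → ℝ → AlphaCSF.Plane, AlphaCSF.IsConvexCompleteSolution α X →
      (∀ p t, 0 < t → X p t ∈ Metric.ball (0 : AlphaCSF.Plane) 1 →
        0 < AlphaCSF.speed α X p t ∧ AlphaCSF.speed α X p t ≤ L) →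
      ∀ p t, 0 < t → X p t ∈ Metric.ball (0 : AlphaCSF.Plane) (1 / 2) →
        DifferentiableAt ℝ (fun q => AlphaCSF.speed α X q t) p ∧
        |AlphaCSF.arcDeriv (fun q => X q t) (fun q => AlphaCSF.speed α X q t) p| ≤
          C * (1 + t ^ (-(1 / 2 : ℝ))) * AlphaCSF.speed α X p t ^ β := by
  refine ⟨√(21 * AlphaCSF.gradientConstant α β L), fun X hX hu p t ht hp => ?_⟩
  rw [mem_ball_zero_iff] at hp
  have hflow := hX.isCurvedFlow hα.ne' fun p t ht hb => (hu p t ht hb).1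
  have hz : (p, t) ∈ AlphaCSF.unitBallRegion X :=
    ⟨⟨mem_univ p, ht⟩, mem_ball_zero_iff.2 (hp.trans (by norm_num))⟩
  refine ⟨hflow.smoothOn_speed.differentiableAt_param hflow.isOpen hz, ?_⟩
  have hmax := hX.sub_mul_sq_localizedSlope_le hα hβ hβ1 hβα hu (half_pos ht)
    (half_le_self ht.le) (r := 3 / 4) (by norm_num) (hp.le.trans (by norm_num))
  rw [sub_half] at hmax
  have hcutoff : 5 / 16 ≤ AlphaCSF.cutoff (3 / 4) X p t := by
    rw [AlphaCSF.cutoff]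
    linarith [pow_le_pow_left₀ (norm_nonneg _) hp.le 2]
  calc |AlphaCSF.spaceDeriv X (AlphaCSF.speed α X) p t|
      = |AlphaCSF.weightedSlope α β X p t| * AlphaCSF.speed α X p t ^ β := by
        rw [hflow.spaceDeriv_speed_eq_weightedSlope_mul β hz, abs_mul,
          abs_of_pos (Real.rpow_pos_of_pos (hflow.speed_pos hz) β)]
    _ ≤ _ := mul_le_mul_of_nonneg_right (AlphaCSF.abs_le_of_mul_sq_le ht hcutoff hmax)
        (Real.rpow_nonneg (hflow.speed_pos hz).le β)

theorem proposition3p1 (α β L : ℝ) (hα : 0 < α) (hβ : 0 < β) (hβ' : β < min 1 α⁻¹) :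
    ∃ C : ℝ, ∀ X : ℝ → ℝ → AlphaCSF.Plane, AlphaCSF.IsStripSolution α X →
      (∀ p t, 0 ≤ t → X p t ∈ Metric.ball (0 : AlphaCSF.Plane) 1 →
        0 < AlphaCSF.speed α X p t ∧ AlphaCSF.speed α X p t ≤ L) →
      ∀ p t, 0 < t → X p t ∈ Metric.ball (0 : AlphaCSF.Plane) (1 / 2) →
        DifferentiableAt ℝ (fun q => AlphaCSF.speed α X q t) p ∧
        |AlphaCSF.arcDeriv (fun q => X q t) (fun q => AlphaCSF.speed α X q t) p| ≤
          C * (1 + t ^ (-(1 / 2 : ℝ))) * AlphaCSF.speed α X p t ^ β := by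
  obtain ⟨C, hC⟩ := proposition3p1_general hα hβ (hβ'.le.trans (min_le_left _ _))
    (hβ'.trans_le (min_le_right _ _)) L
  exact ⟨C, fun X hX hu => hC X hX.solution fun p t ht => hu p t ht.le⟩
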